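/- Setting. Let $T>0$, $n_2\in\mathbb Z_+$, and let $(b_n)_{n\in\mathbb N}$ be real numbers with $b_n\ge 1$, $b_n\to\infty$. On a probability space $(\Omega,\mathcal F,P)$ let, for every $n$, $N^{k}=N^{k,n}$ ($1\le k\le n_2+2$) be simple point processes, i.e. càdlàg $\mathbb Z_+$-valued processes with $N^k_0=0$ all of whose jumps equal $1$. Put $S^i=\inf\{t\ge0:N^1_t\ge i\}\wedge T$, $T^j=\inf\{t\ge 0:N^2_t\ge j\}\wedge T$, $\mathcal T_k^j=\inf\{t\ge0:N^{k+2}_t\ge j\}\wedge T$ (with $\inf\emptyset=+\infty$), $\Pi_n=((S^i)_i,(T^j)_j,(\mathcal T^j_k)_{j,k})$, $l_n=N^1_{T-}+1$, $m_n=N^2_{T-}+1$, $m_n^k=N^{k+2}_{T-}+1$, $I^i=[S^{i-1},S^i]$ ($1\le i\le l_n$), $J^j=[T^{j-1},T^j]$ ($1\le j\le m_n$), let $|K|$ be the length and $L(K)$ the left end point of an interval $K$, and let $$r_n=\max_{i,j}(|I^i|\vee|J^j|)\vee\max_{k}\max_{1\le j\le m_n^k}|\mathcal T_k^j-\mathcal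 T_k^{j-1}|.$$ Let $\ast$ denote the transpose, $G=\{|I\cap J|/\sqrt{|I||J|}\}_{I,J}$, and for a complex $l_n\times m_n$ matrix $\mathcal C$ with entries of modulus less than $1$ let $$M(\mathcal C)=\begin{pmatrix}M^{11}&M^{12}\\(M^{12})^*&M^{22}\end{pmatrix}=\begin{pmatrix}1&L\\L^*&1\end{pmatrix}^{-1},\qquad L=\{\mathcal C_{IJ}G_{IJ}\}_{I,J},$$ $$A_n(\mathcal C^1,\mathcal C^2,\mathcal C^3,\mathcal C^4)=\mathrm{tr}(M^{11}(\mathcal C^4)\mathcal C^1)+2\,\mathrm{tr}((M^{12}(\mathcal C^4))^*\mathcal C^3)+\mathrm{tr}(M^{22}(\mathcal C^4)\mathcal C^2).$$ Let $\mathbf 1$ be the $l_n\times m_n$ matrix with all entries $1$, $\mathcal E^1(t)=\mathrm{diag}(1_{\{I^i\cap[0,t]\ne\emptyset\}})_i$, $\mathcal E^2(t)=\mathrm{diag}(1_{\{J^j\cap[0,t]\neq\emptyset\}})_j$, and for $p\in\mathbb Z_+$ let $$\nu_n^{p,1}=b_n^{-1}\sum_I((GG^*)^p)_{II}\,\delta_{L(I)},\quad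 \nu_n^{p,2}=b_n^{-1}\sum_J((G^*G)^p)_{JJ}\,\delta_{L(J)},\quad \Psi^{p,i}(f,g)=\int_0^Tf\,d\nu_n^{p,i}-\int_0^Tf(s)g(s)\,ds.$$ Call a process on $[0,T]$ admissible if it is left-continuous on $(0,T]$, $\sigma(\{\Pi_n\}_n)$-measurable at every time, and almost surely integrable on $[0,T]$. All limits are as $n\to\infty$, and $\to^p$ is convergence in probability. Conditions. [A2] $r_n\to^p0$. [A3] There are admissible real processes $a_0,c_0$ such that for all $t\in(0,T]$ $$\Psi^{0,1}(1_{[0,t]},a_0)\to^p0\quad\text{and}\quad\Psi^{0,2}(1_{[0,t]},c_0)\to^p0,\tag{5}$$ and at least one of the following holds. (1) There are $\eta\in(0,1)$ and complex processes $a(z,t)$, admissible for each $|z|<\eta$ and continuous in $z$ on $\{|z|<\eta\}$ for each $t$, with $b_n^{-1}A_n(\mathcal E^1(t),0,0,z\mathbf 1)\to^p\int_0^ta(z,s)\,ds$ for $|z|<\eta$, $t\in(0,T]$. (2) The same with $c(z,t)$ and $b_n^{-1}A_n(0,\mathcal E^2(t),0,z\mathbf 1)$. [A3'] There are admissible real processes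 $a_0,c_0$ satisfying (5) for all $t\in(0,T]$, and at least one of the following holds. (1) For every $p\ge1$ there is an admissible real process $a_p$ with $\Psi^{p,1}(1_{[0,t]},a_p)\to^p0$ for all $t\in(0,T]$. (2) For every $p\ge1$ there is an admissible real process $c_p$ with $\Psi^{p,2}(1_{[0,t]},c_p)\to^p0$ for all $t\in(0,T]$. Proposition 2. Assume [A2]. Then [A3] and [A3'] are equivalent. Moreover, assume also [A3], with processes $a_0,c_0$. Then processes $(a_p)_{p\ge1}$ and $(c_p)_{p\ge1}$ as in [A3'](1) and [A3'](2) exist, and processes $a(z,t)$ and $c(z,t)$ as in [A3](1) and [A3](2) exist, even with $\{|z|<1\}$ in place of $\{|z|<\eta\}$. For any such processes, almost surely, for all $t\in(0,T]$, $$a(z,t)=\sum_{p=0}^\infty a_p(t)z^{2p},\qquad c(z,t)=\sum_{p=0}^\infty c_p(t)z^{2p}$$ for all $z$ in the disc on which $a$, respectively $c$, is given, and both series converge for every $z=\rho\in(-1,1)$, where they define $a(\rho,t)$ and $c(\rho,t)$. Finally, for all $x,y\in\mathbb R$, $\rho,\rho_*\in(-1,1)$ and $t\in(0,T]$, the function $s\mapsto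 A(x,y,\rho,\rho_*,s)$ is almost surely integrable on $[0,t]$ and $$b_n^{-1}A_n\big(x^2\mathcal E^1(t),\,y^2\mathcal E^2(t),\,xy\rho_*\mathcal E^1(t)G,\,\rho\mathbf 1\big)\to^p\int_0^tA(x,y,\rho,\rho_*,s)\,ds,$$ where $$A(x,y,\rho,\rho_*,t)=x^2a(\rho,t)+y^2c(\rho,t)-2xy\,(a(\rho,t)-a_0(t))\,\frac{\rho_*}{\rho}1_{\{\rho\ne0\}}.$$ -/

import Mathlib

open MeasureTheory Filter Topology Set

noncomputable section

/-- Path of a simple point process: an `ℕ`-valued càdlàg function on `[0, ∞)` starting at `0`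
all of whose jumps are equal to `1`. -/
structure IsSimplePointPath (N : ℝ → ℕ) : Prop where
  zero : N 0 = 0
  rightCont : ∀ t, 0 ≤ t → ContinuousWithinAt N (Ici t) t
  jump : ∀ t, 0 < t → ∃ y : ℕ, Tendsto N (𝓝[<] t) (𝓝 y) ∧ (N t = y ∨ N t = y + 1)

/-- Simple point processes, with `N t ω` the value at time `t`. -/
structure IsSimplePointProcess {Ω : Type*} [MeasurableSpace Ω] (N : ℝ → Ω → ℕ) : Prop where
  measurable : ∀ t, 0 ≤ t → Measurable (N t)
  path : ∀ ω, IsSimplePointPath (fun t => N t ω)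

/-! ### Quantities attached to one or two observation paths -/

namespace Obs

/-- `j`-th observation time `inf {t ≥ 0 ; N t ≥ j} ∧ T` (the infimum of the empty set being `∞`). -/
def time (T : ℝ) (N : ℝ → ℕ) (j : ℕ) : ℝ := sInf (insert T {t : ℝ | 0 ≤ t ∧ j ≤ N t})

/-- Observation count `N (T-) + 1`. -/
def count (T : ℝ) (N : ℝ → ℕ) : ℕ := Function.leftLim N T + 1

/-- Observation interval number `j` (numbered from `0`). -/
def interval (T : ℝ) (N : ℝ → ℕ) (j : Fin (count T N)) : Set ℝ :=
  Icc (time T N j) (time T N ((j : ℕ) + 1))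

/-- `G i j = |I i ∩ J j| / (√|I i| √|J j|)`. -/
def G (T : ℝ) (N₁ N₂ : ℝ → ℕ) : Matrix (Fin (count T N₁)) (Fin (count T N₂)) ℝ :=
  Matrix.of fun i j => volume.real (interval T N₁ i ∩ interval T N₂ j) /
    (√(volume.real (interval T N₁ i)) * √(volume.real (interval T N₂ j)))

/-- The diagonal matrix with entries `1_{I i ∩ [0, t] ≠ ∅}`. -/
def E (T : ℝ) (N : ℝ → ℕ) (t : ℝ) : Matrix (Fin (count T N)) (Fin (count T N)) ℂ :=
  open Classical in
  Matrix.diagonal fun i => if (interval T N i ∩ Icc 0 t).Nonempty then 1 else 0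

/-- The matrix `L` with entries `C i j * G i j`. -/
def L (T : ℝ) (N₁ N₂ : ℝ → ℕ) (C : Matrix (Fin (count T N₁)) (Fin (count T N₂)) ℂ) :
    Matrix (Fin (count T N₁)) (Fin (count T N₂)) ℂ :=
  Matrix.of fun i j => C i j * (G T N₁ N₂ i j : ℂ)

/-- The matrix `M = (1 + L̃)⁻¹`, where `L̃` has off-diagonal blocks `L` and its transpose. -/
def M (T : ℝ) (N₁ N₂ : ℝ → ℕ) (C : Matrix (Fin (count T N₁)) (Fin (count T N₂)) ℂ) :
    Matrix (Fin (count T N₁) ⊕ Fin (count T N₂)) (Fin (count T N₁) ⊕ Fin (count T N₂)) ℂ :=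
  (1 + Matrix.fromBlocks 0 (L T N₁ N₂ C) (L T N₁ N₂ C).transpose 0)⁻¹

/-- `A (C₁, C₂, C₃, C₄) = tr (M₁₁(C₄) C₁) + 2 tr (M₁₂(C₄)* C₃) + tr (M₂₂(C₄) C₂)`, where `*` is
the transpose. -/
def A (T : ℝ) (N₁ N₂ : ℝ → ℕ)
    (C₁ : Matrix (Fin (count T N₁)) (Fin (count T N₁)) ℂ)
    (C₂ : Matrix (Fin (count T N₂)) (Fin (count T N₂)) ℂ)
    (C₃ C₄ : Matrix (Fin (count T N₁)) (Fin (count T N₂)) ℂ) : ℂ :=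
  ((M T N₁ N₂ C₄).toBlocks₁₁ * C₁).trace
    + 2 * ((M T N₁ N₂ C₄).toBlocks₁₂.transpose * C₃).trace
    + ((M T N₁ N₂ C₄).toBlocks₂₂ * C₂).trace

end Obs

/-! ### The sequence of sampling schemes -/

/-- A sequence of nonsynchronous sampling schemes on `[0, T]`. For each `n`, the simple point
processes `N n k`, `k < n₂ + 2`, generate the observation times; `k = 0` and `k = 1` give the times
`S^i` and `T^j`, the other ones the times of the `n₂` components of the covariate. -/
structure SamplingScheme (Ω : Type*) [MeasurableSpace Ω] where
  /-- time horizon -/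
  T : ℝ
  T_pos : 0 < T
  /-- dimension of the covariate -/
  n₂ : ℕ
  /-- order of the observation counts -/
  b : ℕ → ℝ
  one_le_b : ∀ n, 1 ≤ b n
  tendsto_b : Tendsto b atTop atTop
  /-- the counting processes -/
  N : ℕ → Fin (n₂ + 2) → ℝ → Ω → ℕ
  simple : ∀ n k, IsSimplePointProcess (N n k)

namespace SamplingScheme

variable {Ω : Type*} [MeasurableSpace Ω] (X : SamplingScheme Ω)

/-- Path of the counting process number `k`. -/
def path (n : ℕ) (k : Fin (X.n₂ + 2)) (ω : Ω) : ℝ → ℕ := fun t => X.N n k t ω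

/-- The σ-algebra `σ({Π_n}_n)` generated by all the observation times. -/
@[reducible] def sigma : MeasurableSpace Ω :=
  ⨆ (n : ℕ) (k : Fin (X.n₂ + 2)) (j : ℕ),
    MeasurableSpace.comap (fun ω => Obs.time X.T (X.path n k ω) j) (borel ℝ)

/-- The mesh `r_n`: the length of the longest observation interval. -/
def mesh (n : ℕ) (ω : Ω) : ℝ :=
  ⨆ (k : Fin (X.n₂ + 2)) (j : Fin (Obs.count X.T (X.path n k ω))),
    (Obs.time X.T (X.path n k ω) ((j : ℕ) + 1) - Obs.time X.T (X.path n k ω) j)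

/-- The matrix `G` of the `n`-th scheme. -/
def G (n : ℕ) (ω : Ω) := Obs.G X.T (X.path n 0 ω) (X.path n 1 ω)

/-- `𝓔¹(t)`. -/
def E₁ (n : ℕ) (ω : Ω) (t : ℝ) := Obs.E X.T (X.path n 0 ω) t

/-- `𝓔²(t)`. -/
def E₂ (n : ℕ) (ω : Ω) (t : ℝ) := Obs.E X.T (X.path n 1 ω) t

/-- The matrix all of whose elements are equal to `1`. -/
def one (n : ℕ) (ω : Ω) :
    Matrix (Fin (Obs.count X.T (X.path n 0 ω))) (Fin (Obs.count X.T (X.path n 1 ω))) ℂ :=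
  Matrix.of fun _ _ => 1

/-- The functional `A_n`. -/
def A (n : ℕ) (ω : Ω) := Obs.A X.T (X.path n 0 ω) (X.path n 1 ω)

/-- The random measure `ν_n^{p,1} = b_n⁻¹ ∑_I ((G G*)^p)_{II} δ_{L(I)}`. -/
def nu₁ (p n : ℕ) (ω : Ω) : Measure ℝ :=
  ∑ i, ENNReal.ofReal ((X.b n)⁻¹ * ((X.G n ω * (X.G n ω).transpose) ^ p) i i) •
    Measure.dirac (Obs.time X.T (X.path n 0 ω) i)

/-- The random measure `ν_n^{p,2} = b_n⁻¹ ∑_J ((G* G)^p)_{JJ} δ_{L(J)}`. -/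
def nu₂ (p n : ℕ) (ω : Ω) : Measure ℝ :=
  ∑ j, ENNReal.ofReal ((X.b n)⁻¹ * (((X.G n ω).transpose * X.G n ω) ^ p) j j) •
    Measure.dirac (Obs.time X.T (X.path n 1 ω) j)

/-- `Ψ^{p,1}(f, g) = ∫_0^T f dν_n^{p,1} - ∫_0^T f g ds`. -/
def Psi₁ (p n : ℕ) (ω : Ω) (f g : ℝ → ℝ) : ℝ :=
  (∫ s in Icc 0 X.T, f s ∂(X.nu₁ p n ω)) - ∫ s in (0 : ℝ)..X.T, f s * g s

/-- `Ψ^{p,2}(f, g) = ∫_0^T f dν_n^{p,2} - ∫_0^T f g ds`. -/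
def Psi₂ (p n : ℕ) (ω : Ω) (f g : ℝ → ℝ) : ℝ :=
  (∫ s in Icc 0 X.T, f s ∂(X.nu₂ p n ω)) - ∫ s in (0 : ℝ)..X.T, f s * g s

/-- `a` is a left-continuous process on `[0, T]`, measurable with respect to `σ({Π_n}_n)`, and
integrable on `[0, T]` almost surely. -/
structure IsDensity (P : Measure Ω) {F : Type*} [NormedAddCommGroup F] [MeasurableSpace F]
    (a : ℝ → Ω → F) : Prop where
  measurable : ∀ t ∈ Icc 0 X.T, Measurable[X.sigma] (a t)
  leftCont : ∀ ω, ∀ t ∈ Ioc 0 X.T, ContinuousWithinAt (fun s => a s ω) (Iic t) t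
  integrable : ∀ᵐ ω ∂P, IntervalIntegrable (fun s => a s ω) volume 0 X.T

/-- Condition [A2]: `r_n → 0` in probability. -/
def A2 (P : Measure Ω) : Prop := TendstoInMeasure P X.mesh atTop (fun _ => 0)

/-- The common first part of [A3] and [A3'], for given processes `a₀` and `c₀`. -/
structure Base (P : Measure Ω) (a₀ c₀ : ℝ → Ω → ℝ) : Prop where
  density₁ : X.IsDensity P a₀
  density₂ : X.IsDensity P c₀
  conv₁ : ∀ t ∈ Ioc 0 X.T, TendstoInMeasure P
    (fun n ω => X.Psi₁ 0 n ω (indicator (Icc 0 t) 1) (fun s => a₀ s ω)) atTop (fun _ => 0)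
  conv₂ : ∀ t ∈ Ioc 0 X.T, TendstoInMeasure P
    (fun n ω => X.Psi₂ 0 n ω (indicator (Icc 0 t) 1) (fun s => c₀ s ω)) atTop (fun _ => 0)

/-- Condition 1 of [A3], for a given radius `η` and a given process `a(z, t)`. -/
structure CondA (P : Measure Ω) (η : ℝ) (a : ℂ → ℝ → Ω → ℂ) : Prop where
  density : ∀ z, ‖z‖ < η → X.IsDensity P (a z)
  cont : ∀ ω, ∀ t ∈ Icc 0 X.T, ContinuousOn (fun z => a z t ω) (Metric.ball 0 η)
  conv : ∀ z, ‖z‖ < η → ∀ t ∈ Ioc 0 X.T, TendstoInMeasure P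
    (fun n ω => ((X.b n)⁻¹ : ℂ) * X.A n ω (X.E₁ n ω t) 0 0 (z • X.one n ω)) atTop
    (fun ω => ∫ s in (0 : ℝ)..t, a z s ω)

/-- Condition 2 of [A3], for a given radius `η` and a given process `c(z, t)`. -/
structure CondC (P : Measure Ω) (η : ℝ) (c : ℂ → ℝ → Ω → ℂ) : Prop where
  density : ∀ z, ‖z‖ < η → X.IsDensity P (c z)
  cont : ∀ ω, ∀ t ∈ Icc 0 X.T, ContinuousOn (fun z => c z t ω) (Metric.ball 0 η)
  conv : ∀ z, ‖z‖ < η → ∀ t ∈ Ioc 0 X.T, TendstoInMeasure P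
    (fun n ω => ((X.b n)⁻¹ : ℂ) * X.A n ω 0 (X.E₂ n ω t) 0 (z • X.one n ω)) atTop
    (fun ω => ∫ s in (0 : ℝ)..t, c z s ω)

/-- Condition 1 of [A3'], for given processes `a p`, `p ≥ 1`. -/
structure CondA' (P : Measure Ω) (a : ℕ → ℝ → Ω → ℝ) : Prop where
  density : ∀ p, 1 ≤ p → X.IsDensity P (a p)
  conv : ∀ p, 1 ≤ p → ∀ t ∈ Ioc 0 X.T, TendstoInMeasure P
    (fun n ω => X.Psi₁ p n ω (indicator (Icc 0 t) 1) (fun s => a p s ω)) atTop (fun _ => 0)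

/-- Condition 2 of [A3'], for given processes `c p`, `p ≥ 1`. -/
structure CondC' (P : Measure Ω) (c : ℕ → ℝ → Ω → ℝ) : Prop where
  density : ∀ p, 1 ≤ p → X.IsDensity P (c p)
  conv : ∀ p, 1 ≤ p → ∀ t ∈ Ioc 0 X.T, TendstoInMeasure P
    (fun n ω => X.Psi₂ p n ω (indicator (Icc 0 t) 1) (fun s => c p s ω)) atTop (fun _ => 0)

/-- Condition [A3], for given `a₀` and `c₀`. -/
def A3With (P : Measure Ω) (a₀ c₀ : ℝ → Ω → ℝ) : Prop :=
  X.Base P a₀ c₀ ∧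
    ((∃ η ∈ Ioo (0 : ℝ) 1, ∃ a, X.CondA P η a) ∨ (∃ η ∈ Ioo (0 : ℝ) 1, ∃ c, X.CondC P η c))

/-- Condition [A3]. -/
def A3 (P : Measure Ω) : Prop := ∃ a₀ c₀, X.A3With P a₀ c₀

/-- Condition [A3']. -/
def A3' (P : Measure Ω) : Prop :=
  ∃ a₀ c₀, X.Base P a₀ c₀ ∧ ((∃ a, X.CondA' P a) ∨ (∃ c, X.CondC' P c))

end SamplingScheme

/-- The sum `∑_{p ≥ 0} a_p(t) ρ^{2p}`. -/
def evenSeries {Ω : Type*} (a : ℕ → ℝ → Ω → ℝ) (ρ t : ℝ) (ω : Ω) : ℝ :=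
  ∑' p, a p t ω * ρ ^ (2 * p)

/-- `x² a(ρ,t) + y² c(ρ,t) - 2xy (a(ρ,t) - a_0(t)) (ρ_*/ρ) 1_{ρ ≠ 0}`, with
`a(ρ,t) = ∑_p a_p(t) ρ^{2p}` and `c(ρ,t) = ∑_p c_p(t) ρ^{2p}`. -/
def limitDensity {Ω : Type*} (a c : ℕ → ℝ → Ω → ℝ) (x y ρ ρs t : ℝ) (ω : Ω) : ℝ :=
  x ^ 2 * evenSeries a ρ t ω + y ^ 2 * evenSeries c ρ t ω
    - 2 * x * y * (evenSeries a ρ t ω - a 0 t ω) * (if ρ ≠ 0 then ρs / ρ else 0)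

end

/-! Write `U p` for the mass that `ν_n^{p,i}` puts on `[0, t]`, that is, `b_n⁻¹` times the sum of
the diagonal entries of `(G G*)^p` (or `(G* G)^p`) over the intervals starting by time `t`. The
Neumann series of the Schur complements of `1 + L̃` shows that `b_n⁻¹ A_n(𝓔¹(t), 0, 0, z𝟏) = ∑ U p
z^{2p}`. So [A3] speaks of a power series and [A3'] of its coefficients, and one has to pass from
either to the other.

What makes this possible is a domination. The vector of the `√|I|` is subinvariant under the
nonnegative symmetric matrix `G G*`, so its powers have diagonal entries in `[0, 1]`; hence the
values and increments of `U p` are at most those of `U 0`, which converges by (5). Partial sums then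
approximate the series with an error of small constant times `U 0`. Conversely, subtracting the
first `q` terms and dividing by `z^{2q}` leaves `U q` up to `O(z²) U 0`, so that letting `z → 0`
along real values recovers the coefficients one after the other. `exists_isDensity_conv_of_approx`
turns such approximations into admissible limits: dominations of increments pass to the
left-continuous densities (`Conv.ae_norm_le`), which makes the approximating densities Cauchy. The
same argument gives uniqueness of densities, hence the formulas for `a(z, t)` and `c(z, t)`.

The two alternatives are tied by the cyclicity of the trace: for `p ≥ 1` both masses sum the same
products over pairs `(I, J)`, and differ only through intervals straddling `t`, by at most `2 /
b_n`. Finally, the mixed term of `A_n` reduces to the series minus its constant term, since `z² R G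
G* = R - 1` for the resolvent `R`. -/

noncomputable section

/-! ### Convergence in probability -/

section InMeasure

variable {Ω : Type*} [MeasurableSpace Ω] {P : Measure Ω}
variable {F F' : Type*} [NormedAddCommGroup F] [NormedAddCommGroup F']

theorem tendstoInMeasure_add {f f' : ℕ → Ω → F} {g g' : Ω → F}
    (h : TendstoInMeasure P f atTop g) (h' : TendstoInMeasure P f' atTop g') :
    TendstoInMeasure P (fun n ω => f n ω + f' n ω) atTop (fun ω => g ω + g' ω) := by
  rw [tendstoInMeasure_iff_norm] at *
  intro ε hε
  have h1 := (h (ε / 2) (by positivity)).add (h' (ε / 2) (by positivity))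
  rw [add_zero] at h1
  refine tendsto_of_tendsto_of_tendsto_of_le_of_le tendsto_const_nhds h1 (fun _ => zero_le) ?_
  intro n
  refine (measure_mono ?_).trans (measure_union_le _ _)
  intro ω hω
  simp only [mem_union, mem_ofPred_eq] at *
  by_contra! hc
  have := norm_add_le (f n ω - g ω) (f' n ω - g' ω)
  rw [show f n ω - g ω + (f' n ω - g' ω) = f n ω + f' n ω - (g ω + g' ω) by abel] at this
  linarith

theorem tendstoInMeasure_map [NormedSpace ℝ F] [NormedSpace ℝ F'] (L : F →L[ℝ] F')
    {f : ℕ → Ω → F} {g : Ω → F} (h : TendstoInMeasure P f atTop g) :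
    TendstoInMeasure P (fun n ω => L (f n ω)) atTop (fun ω => L (g ω)) := by
  rw [tendstoInMeasure_iff_norm] at *
  intro ε hε
  have hL : 0 < ‖L‖ + 1 := by positivity
  refine tendsto_of_tendsto_of_tendsto_of_le_of_le tendsto_const_nhds
    (h (ε / (‖L‖ + 1)) (by positivity)) (fun _ => zero_le) ?_
  intro n
  refine measure_mono fun ω hω => ?_
  simp only [mem_ofPred_eq] at *
  rw [div_le_iff₀ hL]
  rw [← map_sub] at hω
  have := L.le_opNorm (f n ω - g ω)
  nlinarith [norm_nonneg (f n ω - g ω)]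

theorem tendstoInMeasure_sub {f f' : ℕ → Ω → F} {g g' : Ω → F}
    (h : TendstoInMeasure P f atTop g) (h' : TendstoInMeasure P f' atTop g') :
    TendstoInMeasure P (fun n ω => f n ω - f' n ω) atTop (fun ω => g ω - g' ω) := by
  have : TendstoInMeasure P (fun n ω => - f' n ω) atTop (fun ω => - g' ω) := by
    rw [tendstoInMeasure_iff_norm] at *
    intro ε hε
    have hs : ∀ n ω, ‖-f' n ω - -g' ω‖ = ‖f' n ω - g' ω‖ := fun n ω => by
      rw [← norm_neg, neg_sub, sub_neg_eq_add, neg_add_eq_sub]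
    simpa only [hs] using h' ε hε
  simpa only [sub_eq_add_neg] using tendstoInMeasure_add h this

theorem tendstoInMeasure_sub_iff {f : ℕ → Ω → F} {g : Ω → F} :
    TendstoInMeasure P (fun n ω => f n ω - g ω) atTop (fun _ => 0) ↔
      TendstoInMeasure P f atTop g := by
  simp only [tendstoInMeasure_iff_norm, sub_zero]

/-- Convergence to zero of a deterministically small perturbation. -/
theorem tendstoInMeasure_of_dist_le {f f' : ℕ → Ω → F} {g : Ω → F}
    (h : TendstoInMeasure P f atTop g) {c : ℕ → ℝ} (hc : Tendsto c atTop (𝓝 0))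
    (hd : ∀ n ω, ‖f n ω - f' n ω‖ ≤ c n) : TendstoInMeasure P f' atTop g := by
  rw [tendstoInMeasure_iff_norm] at *
  intro ε hε
  refine tendsto_of_tendsto_of_tendsto_of_le_of_le' tendsto_const_nhds
    (h (ε / 2) (by positivity)) (.of_forall fun _ => zero_le) ?_
  filter_upwards [hc.eventually (gt_mem_nhds (half_pos hε))] with n hn
  refine measure_mono fun ω hω => ?_
  simp only [mem_ofPred_eq] at *
  have h1 := norm_sub_le (f n ω - g ω) (f n ω - f' n ω)
  rw [show f n ω - g ω - (f n ω - f' n ω) = f' n ω - g ω by abel] at h1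
  linarith [hd n ω]

/-- Tightness of one real variable: `B / (k + 1)` tends to zero pointwise, hence in measure. -/
theorem tendsto_measure_ge_atTop_zero [IsFiniteMeasure P] {B : Ω → ℝ} (hB : AEMeasurable B P) :
    Tendsto (fun k : ℕ => P {ω | (k : ℝ) + 1 ≤ B ω}) atTop (𝓝 0) := by
  have h : TendstoInMeasure P (fun (k : ℕ) ω => B ω / ((k : ℝ) + 1)) atTop (fun _ => 0) := by
    refine tendstoInMeasure_of_tendsto_ae
      (fun n => (hB.div_const _).aestronglyMeasurable) (.of_forall fun ω => ?_)
    have := (tendsto_one_div_add_atTop_nhds_zero_nat (𝕜 := ℝ)).const_mul (B ω)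
    simpa [div_eq_mul_inv] using this
  rw [tendstoInMeasure_iff_norm] at h
  refine tendsto_of_tendsto_of_tendsto_of_le_of_le tendsto_const_nhds
    (h 1 one_pos) (fun _ => zero_le) fun n => measure_mono fun ω hω => ?_
  simp only [mem_ofPred_eq, sub_zero] at *
  refine le_trans ?_ (le_abs_self _)
  rwa [le_div_iff₀ (by positivity), one_mul]

/-- The approximation error is relative to `h n`, which is random and unbounded. Off an event of
small probability its limit `B` is below some `K + 1`, so `h n ≤ K + 2` with high probability for
large `n`; then `k` is fixed with `ε k * (K + 2)` small before `n` tends to infinity. -/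
theorem tendstoInMeasure_of_approx [IsFiniteMeasure P] {f : ℕ → Ω → F} {g : Ω → F}
    {fk : ℕ → ℕ → Ω → F} {gk : ℕ → Ω → F} {h : ℕ → Ω → ℝ} {B : Ω → ℝ} {ε : ℕ → ℝ}
    (hε : Tendsto ε atTop (𝓝 0)) (hε0 : ∀ k, 0 ≤ ε k)
    (hfk : ∀ k, TendstoInMeasure P (fk k) atTop (gk k)) (hh : TendstoInMeasure P h atTop B)
    (hB : AEMeasurable B P) (hf : ∀ k n ω, ‖f n ω - fk k n ω‖ ≤ ε k * h n ω)
    (hg : ∀ k, ∀ᵐ ω ∂P, ‖gk k ω - g ω‖ ≤ ε k * B ω) : TendstoInMeasure P f atTop g := by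
  rw [tendstoInMeasure_iff_norm]
  intro δ hδ
  rw [ENNReal.tendsto_nhds_zero]
  intro η hη
  have hη3 : 0 < η / 3 := ENNReal.div_pos hη.ne' (by simp)
  obtain ⟨K, hK⟩ := ((ENNReal.tendsto_nhds_zero.1 (tendsto_measure_ge_atTop_zero hB)) _ hη3).exists
  have hk' : Tendsto (fun k => ε k * ((K : ℝ) + 2)) atTop (𝓝 0) := by
    simpa using hε.mul_const ((K : ℝ) + 2)
  obtain ⟨k, hk⟩ := (hk'.eventually (gt_mem_nhds (show 0 < δ / 3 by positivity))).exists
  have h1 := ENNReal.tendsto_nhds_zero.1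
    ((tendstoInMeasure_iff_norm.1 (hfk k)) (δ / 3) (by positivity)) _ hη3
  have h2 := ENNReal.tendsto_nhds_zero.1
    ((tendstoInMeasure_iff_norm.1 hh) 1 one_pos) _ hη3
  filter_upwards [h1, h2] with n hn1 hn2
  have hsub : {ω | δ ≤ ‖f n ω - g ω‖} ≤ᵐ[P]
      (({ω | δ / 3 ≤ ‖fk k n ω - gk k ω‖} ∪ {ω | 1 ≤ ‖h n ω - B ω‖}) ∪
        {ω | (K : ℝ) + 1 ≤ B ω} : Set Ω) := by
    filter_upwards [hg k] with ω hω hlt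
    change ω ∈ ((_ ∪ _) ∪ _ : Set Ω)
    change δ ≤ ‖f n ω - g ω‖ at hlt
    simp only [mem_union, mem_ofPred_eq]
    by_contra! hc
    obtain ⟨⟨hc1, hc2⟩, hc3⟩ := hc
    have h3 : h n ω ≤ (K : ℝ) + 2 := by
      have := (abs_lt.1 hc2).2
      linarith
    have h4 : ‖f n ω - g ω‖ ≤ ‖f n ω - fk k n ω‖ + ‖fk k n ω - gk k ω‖ + ‖gk k ω - g ω‖ := by
      have := norm_add₃_le (a := f n ω - fk k n ω) (b := fk k n ω - gk k ω) (c := gk k ω - g ω)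
      simpa using this
    have h5 := mul_le_mul_of_nonneg_left h3 (hε0 k)
    have h6 : ε k * B ω ≤ ε k * ((K : ℝ) + 2) :=
      mul_le_mul_of_nonneg_left (by linarith) (hε0 k)
    linarith [hf k n ω]
  calc P {ω | δ ≤ ‖f n ω - g ω‖} ≤ _ := measure_mono_ae hsub
    _ ≤ _ := (measure_union_le _ _).trans (add_le_add_left (measure_union_le _ _) _)
    _ ≤ η / 3 + η / 3 + η / 3 := add_le_add (add_le_add hn1 hn2) hK
    _ = η := ENNReal.add_thirds η

end InMeasure

/-- If increments of the primitive of `a` are dominated by increments of the primitive of `b` at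
rational points, then left limits are dominated as well. -/
theorem norm_le_of_integral_le {F : Type*} [NormedAddCommGroup F] [NormedSpace ℝ F]
    [CompleteSpace F] {a : ℝ → F} {b : ℝ → ℝ} {T ε t : ℝ} (hε : 0 ≤ ε)
    (ha : IntervalIntegrable a volume 0 T) (hb : IntervalIntegrable b volume 0 T)
    (ht : t ∈ Ioc 0 T) (hac : ContinuousWithinAt a (Iic t) t)
    (hbc : ContinuousWithinAt b (Iic t) t)
    (h : ∀ q r : ℚ, (q : ℝ) ∈ Ioo 0 T → (r : ℝ) ∈ Ioo 0 T → q < r →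
      ‖(∫ s in (0 : ℝ)..r, a s) - ∫ s in (0 : ℝ)..q, a s‖ ≤
        ε * ((∫ s in (0 : ℝ)..r, b s) - ∫ s in (0 : ℝ)..q, b s)) :
    ‖a t‖ ≤ ε * b t := by
  refine le_of_forall_pos_le_add fun δ hδ => ?_
  -- Replacing `a` and `b` by their values at `t` costs `r` and `ε * r` per unit of time, in total
  -- `δ`.
  set r := δ / (1 + ε) with hr
  have hr0 : 0 < r := by positivity
  have e1 : ∀ᶠ s in 𝓝[Iic t] t, ‖a s - a t‖ < r := by
    have := Metric.tendsto_nhds.1 hac r hr0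
    simpa [dist_eq_norm] using this
  have e2 : ∀ᶠ s in 𝓝[Iic t] t, ‖b s - b t‖ < r := by
    have := Metric.tendsto_nhds.1 hbc r hr0
    simpa only [dist_eq_norm] using this
  obtain ⟨l, hl, hl'⟩ := (mem_nhdsLE_iff_exists_Ioc_subset).1 (e1.and e2)
  have hl0 : max l 0 < t := max_lt hl ht.1
  obtain ⟨q, hq1, hq2⟩ := exists_rat_btwn hl0
  obtain ⟨p, hp1, hp2⟩ := exists_rat_btwn hq2
  have hq0 : 0 < (q : ℝ) := lt_of_le_of_lt (le_max_right _ _) hq1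
  have hql : l < (q : ℝ) := lt_of_le_of_lt (le_max_left _ _) hq1
  have hpT : (p : ℝ) < T := hp2.trans_le ht.2
  have hsub : ∀ s ∈ Set.uIoc (q : ℝ) p, ‖a s - a t‖ < r ∧ ‖b s - b t‖ < r := by
    intro s hs
    rw [uIoc_of_le hp1.le] at hs
    exact hl' ⟨hql.trans hs.1, hs.2.trans hp2.le⟩
  have hm : ∀ x y : ℝ, 0 ≤ x → x ≤ y → y ≤ T → Set.uIcc x y ⊆ Set.uIcc 0 T := by
    intro x y hx hxy hy
    rw [uIcc_of_le hxy, uIcc_of_le (hx.trans (hxy.trans hy))]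
    exact Icc_subset_Icc hx hy
  have key := h q p ⟨hq0, hp1.trans hpT⟩ ⟨hq0.trans hp1, hpT⟩ (by exact_mod_cast hp1)
  have i1 := hm 0 p le_rfl (hq0.trans hp1).le hpT.le
  have i2 := hm 0 q le_rfl hq0.le (hp1.trans hpT).le
  have i3 := hm q p hq0.le hp1.le hpT.le
  rw [intervalIntegral.integral_interval_sub_left (ha.mono_set i1) (ha.mono_set i2),
    intervalIntegral.integral_interval_sub_left (hb.mono_set i1) (hb.mono_set i2)] at key
  have k1 := intervalIntegral.norm_integral_le_of_norm_le_const (fun s hs => (hsub s hs).1.le)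
  have k2 := intervalIntegral.norm_integral_le_of_norm_le_const (fun s hs => (hsub s hs).2.le)
  have hpq : 0 < (p : ℝ) - q := sub_pos.2 hp1
  rw [intervalIntegral.integral_sub (ha.mono_set i3) (by simp), intervalIntegral.integral_const,
    abs_of_pos hpq] at k1
  rw [intervalIntegral.integral_sub (hb.mono_set i3) (by simp), intervalIntegral.integral_const,
    abs_of_pos hpq] at k2
  have k3 : (p - q : ℝ) * ‖a t‖ ≤ ‖∫ s in (q : ℝ)..p, a s‖ + r * (p - q) := by
    have := norm_sub_norm_le ((p - q : ℝ) • a t) (∫ s in (q : ℝ)..p, a s)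
    rw [norm_smul, Real.norm_of_nonneg hpq.le, norm_sub_rev] at this
    linarith
  have k4 : (∫ s in (q : ℝ)..p, b s) ≤ (p - q) * b t + r * (p - q) := by
    have := (abs_le.1 k2).2
    rw [smul_eq_mul] at this
    linarith
  have k5 := mul_le_mul_of_nonneg_left k4 hε
  have k6 : (p - q : ℝ) * ‖a t‖ ≤ (p - q) * (ε * b t + δ) := by
    have : δ = r * (1 + ε) := by rw [hr]; field_simp
    rw [this]
    nlinarith
  exact le_of_mul_le_mul_left k6 hpq

theorem intervalIntegrable_of_mem_Icc {F : Type*} [NormedAddCommGroup F] {f : ℝ → F} {T t : ℝ}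
    (h : IntervalIntegrable f volume 0 T) (ht : t ∈ Icc 0 T) : IntervalIntegrable f volume 0 t := by
  refine h.mono_set ?_
  rw [uIcc_of_le ht.1, uIcc_of_le (ht.1.trans ht.2)]
  exact Icc_subset_Icc le_rfl ht.2

/-! ### Measurability of the observation times -/

namespace Obs

variable {T : ℝ} {N : ℝ → ℕ}

theorem bddBelow_time_set (hT : 0 < T) (j : ℕ) :
    BddBelow (insert T {t : ℝ | 0 ≤ t ∧ j ≤ N t}) :=
  ⟨0, by rintro x (rfl | hx); exacts [hT.le, hx.1]⟩

theorem time_nonneg (hT : 0 < T) (j : ℕ) : 0 ≤ time T N j :=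
  le_csInf (insert_nonempty _ _) (by rintro x (rfl | hx); exacts [hT.le, hx.1])

theorem time_mono (hT : 0 < T) : Monotone (time T N) := fun _ _ hij =>
  csInf_le_csInf (bddBelow_time_set hT _) (insert_nonempty _ _)
    (insert_subset_insert fun _ ht => ⟨ht.1, hij.trans ht.2⟩)

/-- Restricting to rational times makes the event a countable union, as measurability requires. -/
theorem time_lt_iff (hT : 0 < T) (hN : IsSimplePointPath N) (j : ℕ) (x : ℝ) :
    time T N j < x ↔ T < x ∨ ∃ q : ℚ, 0 ≤ (q : ℝ) ∧ (q : ℝ) < x ∧ j ≤ N q := by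
  rw [time, csInf_lt_iff (bddBelow_time_set hT j) (insert_nonempty _ _)]
  constructor
  · rintro ⟨t, rfl | ht, htx⟩
    · exact Or.inl htx
    · right
      -- A right-continuous integer-valued path is constant just after `t`, so a nearby rational
      -- time has the same count.
      have h1 : ∀ᶠ s in 𝓝[Ici t] t, N s = N t :=
        (hN.rightCont t ht.1).eventually (by simp : ∀ᶠ y in 𝓝 (N t), y = N t)
      obtain ⟨u, hu, hu'⟩ := mem_nhdsGE_iff_exists_Ico_subset.1 h1
      obtain ⟨q, hq1, hq2⟩ := exists_rat_btwn (lt_min hu htx)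
      refine ⟨q, ht.1.trans hq1.le, hq2.trans_le (min_le_right _ _), ?_⟩
      have : N q = N t := hu' ⟨hq1.le, hq2.trans_le (min_le_left _ _)⟩
      rw [this]; exact ht.2
  · rintro (h | ⟨q, hq0, hqx, hq⟩)
    · exact ⟨T, mem_insert _ _, h⟩
    · exact ⟨q, Or.inr ⟨hq0, hq⟩, hqx⟩

end Obs

/-! ### Admissible processes -/

namespace SamplingScheme

/-- A process set to zero outside of an event and at time zero. -/
def truncate {Ω F : Type*} [Zero F] (S : Set Ω) (a : ℝ → Ω → F) (t : ℝ) (ω : Ω) : F :=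
  open Classical in if ω ∈ S ∧ 0 < t then a t ω else 0

theorem truncate_of_mem {Ω F : Type*} [Zero F] {S : Set Ω} {a : ℝ → Ω → F} {t : ℝ} {ω : Ω}
    (hω : ω ∈ S) (ht : 0 < t) :
    truncate S a t ω = a t ω := if_pos ⟨hω, ht⟩

theorem truncate_of_not {Ω F : Type*} [Zero F] {S : Set Ω} {a : ℝ → Ω → F} {t : ℝ} {ω : Ω}
    (h : ¬ (ω ∈ S ∧ 0 < t)) :
    truncate S a t ω = 0 := if_neg h

variable {Ω : Type*} [mΩ : MeasurableSpace Ω] (X : SamplingScheme Ω)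

theorem measurable_time (n : ℕ) (k : Fin (X.n₂ + 2)) (j : ℕ) :
    Measurable (fun ω => Obs.time X.T (X.path n k ω) j) := by
  refine measurable_of_Iio fun x => ?_
  have : (fun ω => Obs.time X.T (X.path n k ω) j) ⁻¹' Iio x =
      {ω | X.T < x ∨ ∃ q : ℚ, 0 ≤ (q : ℝ) ∧ (q : ℝ) < x ∧ j ≤ X.N n k q ω} := by
    ext ω
    exact Obs.time_lt_iff X.T_pos ((X.simple n k).path ω) j x
  rw [this]
  rw [ofPred_or, ofPred_exists]
  refine (MeasurableSet.const _).union ?_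
  refine MeasurableSet.iUnion fun q => ?_
  by_cases hq : 0 ≤ (q : ℝ)
  · exact (MeasurableSet.const _).inter ((MeasurableSet.const _).inter
      ((X.simple n k).measurable q hq (measurableSet_Ici (a := j))))
  · simp [hq]

theorem sigma_le : X.sigma ≤ mΩ :=
  iSup_le fun n => iSup_le fun k => iSup_le fun j => (X.measurable_time n k j).comap_le

variable {X} {P : Measure Ω}
variable {F : Type*} [NormedAddCommGroup F] [MeasurableSpace F]

theorem IsDensity.map {F' : Type*} [NormedAddCommGroup F'] [MeasurableSpace F']
    [NormedSpace ℝ F] [NormedSpace ℝ F'] [OpensMeasurableSpace F] [BorelSpace F']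
    {a : ℝ → Ω → F} (ha : X.IsDensity P a) (L : F →L[ℝ] F') :
    X.IsDensity P (fun t ω => L (a t ω)) where
  measurable t ht := L.continuous.measurable.comp (ha.measurable t ht)
  leftCont ω t ht := L.continuous.continuousAt.comp_continuousWithinAt (ha.leftCont ω t ht)
  integrable := ha.integrable.mono fun _ h =>
    ⟨L.integrable_comp h.1, L.integrable_comp h.2⟩

theorem IsDensity.add [BorelSpace F] [SecondCountableTopology F] {a a' : ℝ → Ω → F}
    (ha : X.IsDensity P a) (ha' : X.IsDensity P a') :
    X.IsDensity P (fun t ω => a t ω + a' t ω) where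
  measurable t ht := (ha.measurable t ht).add (ha'.measurable t ht)
  leftCont ω t ht := (ha.leftCont ω t ht).add (ha'.leftCont ω t ht)
  integrable := by
    filter_upwards [ha.integrable, ha'.integrable] with ω h h' using h.add h'

theorem isDensity_zero : X.IsDensity P (fun _ _ => (0 : F)) where
  measurable _ _ := measurable_const
  leftCont _ _ _ := continuousWithinAt_const
  integrable := .of_forall fun _ => by simp

theorem IsDensity.sub [NormedSpace ℝ F] [BorelSpace F] [SecondCountableTopology F]
    {a a' : ℝ → Ω → F} (ha : X.IsDensity P a) (ha' : X.IsDensity P a') :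
    X.IsDensity P (fun t ω => a t ω - a' t ω) := by
  simpa [sub_eq_add_neg] using ha.add (ha'.map (-ContinuousLinearMap.id ℝ F))

theorem IsDensity.sum [BorelSpace F] [SecondCountableTopology F] {ι : Type*} (s : Finset ι)
    {a : ι → ℝ → Ω → F} (ha : ∀ i ∈ s, X.IsDensity P (a i)) :
    X.IsDensity P (fun t ω => ∑ i ∈ s, a i t ω) := by
  classical
  induction s using Finset.induction_on with
  | empty => simpa using isDensity_zero
  | insert i s hi ih =>
    simp only [Finset.sum_insert hi]
    exact (ha i (Finset.mem_insert_self _ _)).add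
      (ih fun j hj => ha j (Finset.mem_insert_of_mem hj))

theorem IsDensity.truncate {a : ℝ → Ω → F} (ha : X.IsDensity P a) {S : Set Ω}
    (hS : MeasurableSet[X.sigma] S) : X.IsDensity P (truncate S a) where
  measurable t ht := by
    classical
    by_cases h0 : 0 < t
    · have : SamplingScheme.truncate S a t = fun ω => if ω ∈ S then a t ω else 0 := by
        ext ω; by_cases hω : ω ∈ S <;> simp [SamplingScheme.truncate, h0, hω]
      rw [this]
      exact Measurable.ite hS (ha.measurable t ht) measurable_const
    · have : SamplingScheme.truncate S a t = fun ω => 0 := by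
        ext ω; simp [SamplingScheme.truncate, h0]
      rw [this]
      exact measurable_const
  leftCont ω t ht := by
    by_cases hω : ω ∈ S
    · refine (ha.leftCont ω t ht).congr_of_eventuallyEq ?_ (truncate_of_mem hω ht.1)
      filter_upwards [mem_nhdsWithin_of_mem_nhds (lt_mem_nhds ht.1)] with s hs
      exact truncate_of_mem hω hs
    · simp only [SamplingScheme.truncate, hω, false_and, if_false]
      exact continuousWithinAt_const
  integrable := by
    filter_upwards [ha.integrable] with ω h
    by_cases hω : ω ∈ S
    · refine h.congr fun s hs => ?_
      rw [uIoc_of_le X.T_pos.le] at hs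
      exact (truncate_of_mem hω hs.1).symm
    · simp [SamplingScheme.truncate, hω]

/-- Uniform limits, relative to a density, of densities are densities. -/
theorem IsDensity.of_approx [BorelSpace F] {d : ℝ → Ω → F}
    {dk : ℕ → ℝ → Ω → F} {b : ℝ → Ω → ℝ} {ε : ℕ → ℝ} (hdk : ∀ k, X.IsDensity P (dk k))
    (hb : X.IsDensity P b) (hε : Tendsto ε atTop (𝓝 0))
    (h : ∀ k ω, ∀ t ∈ Ioc 0 X.T, ‖dk k t ω - d t ω‖ ≤ ε k * b t ω)
    (h0 : Measurable[X.sigma] (d 0)) : X.IsDensity P d := by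
  have hlim : ∀ ω, ∀ t ∈ Ioc 0 X.T, Tendsto (fun k => dk k t ω) atTop (𝓝 (d t ω)) := by
    intro ω t ht
    rw [tendsto_iff_norm_sub_tendsto_zero]
    refine squeeze_zero (fun _ => norm_nonneg _) (fun k => h k ω t ht) ?_
    simpa using hε.mul_const (b t ω)
  refine ⟨fun t ht => ?_, fun ω t ht => ?_, ?_⟩
  · rcases ht.1.eq_or_lt with rfl | h1
    · exact h0
    · exact @measurable_of_tendsto_metrizable Ω F X.sigma _ _ _ _ _ _
        (fun k => (hdk k).measurable t ht) (tendsto_pi_nhds.2 fun ω => hlim ω t ⟨h1, ht.2⟩)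
  · refine continuousWithinAt_of_locally_uniform_approx_of_continuousWithinAt self_mem_Iic
      fun u hu => ?_
    obtain ⟨δ, hδ, hδu⟩ := Metric.mem_uniformity_dist.1 hu
    have hε' : Tendsto (fun k => |ε k| * (|b t ω| + 1)) atTop (𝓝 0) := by
      simpa using hε.abs.mul_const (|b t ω| + 1)
    obtain ⟨k, hk⟩ := (hε'.eventually (gt_mem_nhds hδ)).exists
    have hbc : ∀ᶠ s in 𝓝[Iic t] t, |b s ω| < |b t ω| + 1 :=
      (hb.leftCont ω t ht).abs.eventually (gt_mem_nhds (lt_add_one _))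
    -- Left-continuity keeps `b` bounded just before `t`, where the relative bound becomes a uniform
    -- one.
    refine ⟨{s | |b s ω| < |b t ω| + 1 ∧ 0 < s ∧ s ≤ t}, ?_, fun s => dk k s ω,
      (hdk k).leftCont ω t ht, fun s hs => hδu ?_⟩
    · filter_upwards [hbc, mem_nhdsWithin_of_mem_nhds (lt_mem_nhds ht.1), self_mem_nhdsWithin]
        with s h1 h2 h3 using ⟨h1, h2, h3⟩
    · rw [dist_comm, dist_eq_norm]
      refine (h k ω s ⟨hs.2.1, hs.2.2.trans ht.2⟩).trans_lt (lt_of_le_of_lt ?_ hk)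
      refine (le_abs_self _).trans ?_
      rw [abs_mul]
      exact mul_le_mul_of_nonneg_left hs.1.le (abs_nonneg _)
  · have hall : ∀ᵐ ω ∂P, ∀ k, IntervalIntegrable (fun s => dk k s ω) volume 0 X.T :=
      ae_all_iff.2 fun k => (hdk k).integrable
    filter_upwards [hall, hb.integrable] with ω h1 h2
    rw [intervalIntegrable_iff_integrableOn_Ioc_of_le X.T_pos.le] at h2 ⊢
    have h1' := fun k => (intervalIntegrable_iff_integrableOn_Ioc_of_le X.T_pos.le).1 (h1 k)
    have hmeas : AEStronglyMeasurable (fun s => d s ω) (volume.restrict (Ioc 0 X.T)) :=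
      aestronglyMeasurable_of_tendsto_ae atTop (fun k => (h1' k).1)
        ((ae_restrict_iff' measurableSet_Ioc).2 (.of_forall fun s hs => hlim ω s hs))
    refine Integrable.mono' (((h1' 0).norm).add (h2.const_mul (ε 0))) hmeas ?_
    refine (ae_restrict_iff' measurableSet_Ioc).2 (.of_forall fun s hs => ?_)
    have := norm_sub_le (dk 0 s ω) (dk 0 s ω - d s ω)
    rw [sub_sub_cancel] at this
    exact this.trans (add_le_add_right (h 0 ω s hs) _)

/-- The event on which a countable family of processes is dominated. -/
theorem exists_measurableSet_forall_norm_le [BorelSpace F] {ι : Type*}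
    [Countable ι] {a : ι → ℝ → Ω → F} {b : ℝ → Ω → ℝ} {ε : ι → ℝ}
    (ha : ∀ i, X.IsDensity P (a i)) (hb : X.IsDensity P b)
    (h : ∀ i, ∀ᵐ ω ∂P, ∀ t ∈ Ioc 0 X.T, ‖a i t ω‖ ≤ ε i * b t ω) :
    ∃ S : Set Ω, MeasurableSet[X.sigma] S ∧ (∀ᵐ ω ∂P, ω ∈ S) ∧
      ∀ ω ∈ S, ∀ i, ∀ t ∈ Ioc 0 X.T, ‖a i t ω‖ ≤ ε i * b t ω := by
  -- Imposing the bound at rational times only keeps the event in `X.sigma`; left-continuity extends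
  -- it to all of `(0, T]`.
  refine ⟨⋂ i, ⋂ q : ℚ, ⋂ _ : (q : ℝ) ∈ Ioo 0 X.T, {ω | ‖a i q ω‖ ≤ ε i * b q ω}, ?_, ?_, ?_⟩
  · refine MeasurableSet.iInter fun i => MeasurableSet.iInter fun q =>
      MeasurableSet.iInter fun hq => ?_
    have hq' : (q : ℝ) ∈ Icc 0 X.T := Ioo_subset_Icc_self hq
    exact measurableSet_le (measurable_norm.comp ((ha i).measurable q hq'))
      (measurable_const.mul (hb.measurable q hq'))
  · filter_upwards [ae_all_iff.2 h] with ω hω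
    simp only [mem_iInter]
    exact fun i q hq => hω i q ⟨hq.1, hq.2.le⟩
  · intro ω hω i t ht
    simp only [mem_iInter] at hω
    have h1 := ((ha i).leftCont ω t ht).norm.tendsto
    have h2 := ((hb.leftCont ω t ht).const_smul (ε i)).tendsto
    by_contra! hc
    have h3 := h2.eventually_lt h1 hc
    obtain ⟨l, hl, hl'⟩ := (mem_nhdsLE_iff_exists_Ioc_subset).1 h3
    obtain ⟨q, hq1, hq2⟩ := exists_rat_btwn (max_lt hl ht.1)
    have h4 : ε i • b q ω < ‖a i q ω‖ := hl' ⟨(le_max_left _ _).trans_lt hq1, hq2.le⟩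
    exact absurd (hω i q ⟨(le_max_right _ _).trans_lt hq1, hq2.trans_le ht.2⟩) (not_le.2 h4)

/-- A left-continuous process is jointly measurable in time and `ω`, being a limit of processes that
are piecewise constant in time. -/
theorem IsDensity.aemeasurable_integral {b : ℝ → Ω → ℝ} (hb : X.IsDensity P b) {t : ℝ}
    (ht : t ∈ Ioc 0 X.T) : AEMeasurable (fun ω => ∫ s in (0 : ℝ)..t, b s ω) P := by
  classical
  have hb' : ∀ s ∈ Icc 0 X.T, Measurable (b s) := fun s hs =>
    (hb.measurable s hs).mono X.sigma_le le_rfl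
  -- At `k = ⌈(n + 1) s⌉` this is a time in `[s - 1 / (n + 1), s]`, so it approaches `s` from the
  -- left; the clamping to `[0, T]` makes `b` measurable at each such time.
  let κ : ℕ → ℤ → ℝ := fun n k => max 0 (min X.T ((k - 1 : ℝ) / (n + 1)))
  let ψ : ℕ → ℝ × Ω → ℝ := fun n p =>
    if p.1 ∈ Ioc 0 X.T then b (κ n ⌈((n : ℝ) + 1) * p.1⌉) p.2 else 0
  let ψ' : ℝ × Ω → ℝ := fun p => if p.1 ∈ Ioc 0 X.T then b p.1 p.2 else 0
  have hψ : ∀ n, Measurable (ψ n) := by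
    intro n
    refine Measurable.ite (measurable_fst measurableSet_Ioc) ?_ measurable_const
    have h1 : Measurable (fun p : Ω × ℤ => b (κ n p.2) p.1) :=
      measurable_from_prod_countable_left fun k => hb' (κ n k)
        ⟨le_max_left _ _, max_le X.T_pos.le (min_le_left _ _)⟩
    exact h1.comp (measurable_snd.prodMk (Int.measurable_ceil.comp (measurable_fst.const_mul _)))
  have hψ' : Measurable ψ' := by
    refine measurable_of_tendsto_metrizable hψ (tendsto_pi_nhds.2 fun p => ?_)
    by_cases hp : p.1 ∈ Ioc 0 X.T
    · simp only [ψ, ψ', hp, if_true]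
      refine (hb.leftCont p.2 p.1 hp).tendsto.comp (tendsto_nhdsWithin_iff.2 ⟨?_, ?_⟩)
      · have hlow : Tendsto (fun n : ℕ => p.1 - 1 / ((n : ℝ) + 1)) atTop (𝓝 p.1) := by
          simpa using (tendsto_one_div_add_atTop_nhds_zero_nat (𝕜 := ℝ)).const_sub p.1
        refine tendsto_of_tendsto_of_tendsto_of_le_of_le hlow tendsto_const_nhds (fun n => ?_)
          (fun n => ?_)
        · have hn : (0 : ℝ) < n + 1 := by positivity
          refine le_trans ?_ (le_max_right _ _)
          refine le_min ?_ ?_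
          · have : 0 < 1 / ((n : ℝ) + 1) := by positivity
            linarith [hp.2]
          · rw [le_div_iff₀ hn, sub_mul, one_div, inv_mul_cancel₀ hn.ne', mul_comm]
            exact sub_le_sub_right (Int.le_ceil _) _
        · have hn : (0 : ℝ) < n + 1 := by positivity
          refine max_le hp.1.le ((min_le_right _ _).trans ?_)
          rw [div_le_iff₀ hn]
          linarith [Int.ceil_lt_add_one (((n : ℝ) + 1) * p.1)]
      · refine .of_forall fun n => ?_
        have hn : (0 : ℝ) < n + 1 := by positivity
        refine max_le hp.1.le ((min_le_right _ _).trans ?_)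
        rw [div_le_iff₀ hn]
        linarith [Int.ceil_lt_add_one (((n : ℝ) + 1) * p.1)]
    · simp only [ψ, ψ', hp, if_false]
      exact tendsto_const_nhds
  have hint : (fun ω => ∫ s in (0 : ℝ)..t, b s ω) = fun ω => ∫ s in Ioc 0 t, ψ' (s, ω) := by
    ext ω
    rw [intervalIntegral.integral_of_le ht.1.le]
    refine setIntegral_congr_fun measurableSet_Ioc fun s hs => ?_
    have : s ∈ Ioc 0 X.T := ⟨hs.1, hs.2.trans ht.2⟩
    simp only [ψ', this, if_true]
  rw [hint]
  exact (hψ'.stronglyMeasurable.integral_prod_left'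
    (μ := volume.restrict (Ioc 0 t))).measurable.aemeasurable

end SamplingScheme

/-! ### Limits with densities, and dominated increments -/

namespace SamplingScheme

variable {Ω : Type*} [mΩ : MeasurableSpace Ω] (X : SamplingScheme Ω)

/-- Convergence in probability of `f n t` to the integral of `a` over `[0, t]`, for every `t`. -/
def Conv (P : Measure Ω) {F : Type*} [NormedAddCommGroup F] [NormedSpace ℝ F]
    (f : ℕ → Ω → ℝ → F) (a : ℝ → Ω → F) : Prop :=
  ∀ t ∈ Ioc 0 X.T, TendstoInMeasure P (fun n ω => f n ω t) atTop
    (fun ω => ∫ s in (0 : ℝ)..t, a s ω)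

/-- The values and the increments of `f` are at most `ε` times those of `g`. -/
structure Dom {Ω F : Type*} [NormedAddCommGroup F] (ε : ℝ) (f : ℕ → Ω → ℝ → F)
    (g : ℕ → Ω → ℝ → ℝ) : Prop where
  le : ∀ n ω t, ‖f n ω t‖ ≤ ε * g n ω t
  incr : ∀ n ω s t, s ≤ t → ‖f n ω t - f n ω s‖ ≤ ε * (g n ω t - g n ω s)

theorem Dom.sub {Ω F : Type*} [NormedAddCommGroup F] {ε ε' : ℝ} {f f' : ℕ → Ω → ℝ → F} {g : ℕ → Ω → ℝ → ℝ} (h : Dom ε f g)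
    (h' : Dom ε' f' g) : Dom (ε + ε') (fun n ω t => f n ω t - f' n ω t) g where
  le n ω t := by
    rw [add_mul]
    exact (norm_sub_le _ _).trans (add_le_add (h.le n ω t) (h'.le n ω t))
  incr n ω s t hst := by
    rw [add_mul, sub_sub_sub_comm]
    exact (norm_sub_le _ _).trans (add_le_add (h.incr n ω s t hst) (h'.incr n ω s t hst))

theorem dom_zero {Ω F : Type*} [NormedAddCommGroup F] (g : ℕ → Ω → ℝ → ℝ) : Dom 0 (fun _ _ _ => (0 : F)) g where
  le := by simp
  incr := by simp

theorem summable_smul {Ω F : Type*} [NormedAddCommGroup F] [NormedSpace ℝ F] [CompleteSpace F]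
    {V : ℕ → ℕ → Ω → ℝ → ℝ} {g : ℕ → Ω → ℝ → ℝ} (hV : ∀ p, Dom 1 (V p) g)
    {c : ℕ → F} (hc : Summable (fun p => ‖c p‖)) (n : ℕ) (ω : Ω) (t : ℝ) :
    Summable (fun p => V p n ω t • c p) := by
  refine Summable.of_norm_bounded (hc.mul_left (g n ω t)) fun p => ?_
  rw [norm_smul]
  exact mul_le_mul_of_nonneg_right (by simpa using (hV p).le n ω t) (norm_nonneg _)

theorem Dom.tsum {Ω F : Type*} [NormedAddCommGroup F] [NormedSpace ℝ F] [CompleteSpace F]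
    {V : ℕ → ℕ → Ω → ℝ → ℝ} {g : ℕ → Ω → ℝ → ℝ} (hV : ∀ p, Dom 1 (V p) g)
    {c : ℕ → F} (hc : Summable (fun p => ‖c p‖)) :
    Dom (∑' p, ‖c p‖) (fun n ω t => ∑' p, V p n ω t • c p) g where
  le n ω t := by
    rw [← tsum_mul_right]
    refine tsum_of_norm_bounded (hc.mul_right _).hasSum fun p => ?_
    rw [norm_smul, mul_comm]
    exact mul_le_mul_of_nonneg_left (by simpa using (hV p).le n ω t) (norm_nonneg _)
  incr n ω s t hst := by
    rw [← tsum_mul_right, ← (summable_smul hV hc n ω t).tsum_sub (summable_smul hV hc n ω s)]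
    refine tsum_of_norm_bounded (hc.mul_right _).hasSum fun p => ?_
    rw [← sub_smul, norm_smul, mul_comm]
    exact mul_le_mul_of_nonneg_left (by simpa using (hV p).incr n ω s t hst) (norm_nonneg _)

variable {X} {P : Measure Ω}
variable {F : Type*} [NormedAddCommGroup F] [NormedSpace ℝ F]

theorem Conv.congr {f : ℕ → Ω → ℝ → F} {a a' : ℝ → Ω → F} (h : X.Conv P f a)
    (he : ∀ᵐ ω ∂P, ∀ t ∈ Ioc 0 X.T, a t ω = a' t ω) : X.Conv P f a' := by
  intro t ht
  refine (h t ht).congr_right ?_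
  filter_upwards [he] with ω hω
  refine intervalIntegral.integral_congr_ae (.of_forall fun s hs => hω s ?_)
  rw [uIoc_of_le ht.1.le] at hs
  exact ⟨hs.1, hs.2.trans ht.2⟩

theorem conv_zero : X.Conv P (fun _ _ _ => (0 : F)) (fun _ _ => 0) := by
  intro t _
  simp [tendstoInMeasure_iff_norm]
  intro ε hε
  simp [not_le.2 hε]

section Measurable

variable [MeasurableSpace F]

theorem Conv.add {f f' : ℕ → Ω → ℝ → F} {a a' : ℝ → Ω → F} (h : X.Conv P f a)
    (h' : X.Conv P f' a') (ha : X.IsDensity P a) (ha' : X.IsDensity P a') :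
    X.Conv P (fun n ω t => f n ω t + f' n ω t) (fun t ω => a t ω + a' t ω) := by
  intro t ht
  refine (tendstoInMeasure_add (h t ht) (h' t ht)).congr_right ?_
  filter_upwards [ha.integrable, ha'.integrable] with ω h1 h2
  exact (intervalIntegral.integral_add (intervalIntegrable_of_mem_Icc h1 (Ioc_subset_Icc_self ht))
    (intervalIntegrable_of_mem_Icc h2 (Ioc_subset_Icc_self ht))).symm

theorem Conv.sub {f f' : ℕ → Ω → ℝ → F} {a a' : ℝ → Ω → F} (h : X.Conv P f a)
    (h' : X.Conv P f' a') (ha : X.IsDensity P a) (ha' : X.IsDensity P a') :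
    X.Conv P (fun n ω t => f n ω t - f' n ω t) (fun t ω => a t ω - a' t ω) := by
  intro t ht
  refine (tendstoInMeasure_sub (h t ht) (h' t ht)).congr_right ?_
  filter_upwards [ha.integrable, ha'.integrable] with ω h1 h2
  exact (intervalIntegral.integral_sub (intervalIntegrable_of_mem_Icc h1 (Ioc_subset_Icc_self ht))
    (intervalIntegrable_of_mem_Icc h2 (Ioc_subset_Icc_self ht))).symm

theorem Conv.map {F' : Type*} [NormedAddCommGroup F'] [NormedSpace ℝ F'] [CompleteSpace F]
    [CompleteSpace F'] (L : F →L[ℝ] F') {f : ℕ → Ω → ℝ → F} {a : ℝ → Ω → F}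
    (h : X.Conv P f a) (ha : X.IsDensity P a) :
    X.Conv P (fun n ω t => L (f n ω t)) (fun t ω => L (a t ω)) := by
  intro t ht
  refine (tendstoInMeasure_map L (h t ht)).congr_right ?_
  filter_upwards [ha.integrable] with ω h1
  exact (L.intervalIntegral_comp_comm
    (intervalIntegrable_of_mem_Icc h1 (Ioc_subset_Icc_self ht))).symm

/-- Domination of the approximating processes passes to the limiting densities. -/
theorem Conv.ae_norm_le [CompleteSpace F] {f : ℕ → Ω → ℝ → F} {a : ℝ → Ω → F} {g : ℕ → Ω → ℝ → ℝ}
    {b : ℝ → Ω → ℝ} {ε : ℝ} (hf : X.Conv P f a) (ha : X.IsDensity P a) (hg : X.Conv P g b)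
    (hb : X.IsDensity P b) (hε : 0 ≤ ε) (hd : Dom ε f g) :
    ∀ᵐ ω ∂P, ∀ t ∈ Ioc 0 X.T, ‖a t ω‖ ≤ ε * b t ω := by
  have key : ∀ᵐ ω ∂P, ∀ q r : ℚ, (q : ℝ) ∈ Ioo 0 X.T → (r : ℝ) ∈ Ioo 0 X.T → q < r →
      ‖(∫ s in (0 : ℝ)..r, a s ω) - ∫ s in (0 : ℝ)..q, a s ω‖ ≤
        ε * ((∫ s in (0 : ℝ)..r, b s ω) - ∫ s in (0 : ℝ)..q, b s ω) := by
    simp only [ae_all_iff]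
    intro q r hq hr hqr
    have hq' := Ioo_subset_Ioc_self hq
    have hr' := Ioo_subset_Ioc_self hr
    have h1 := tendstoInMeasure_sub (hf r hr') (hf q hq')
    have h2 := tendstoInMeasure_sub (hg r hr') (hg q hq')
    -- The second subsequence is extracted from the first, so that both increments converge almost
    -- surely along it. The pairs of rationals being countable, one null set suffices.
    obtain ⟨ns, hns, h1'⟩ := h1.exists_seq_tendsto_ae
    obtain ⟨ns', hns', h2'⟩ := (h2.comp hns.tendsto_atTop).exists_seq_tendsto_ae
    filter_upwards [h1', h2'] with ω k1 k2
    refine le_of_tendsto_of_tendsto (k1.comp hns'.tendsto_atTop).norm (k2.const_mul ε) ?_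
    exact .of_forall fun n => hd.incr _ ω _ _ (by exact_mod_cast hqr.le)
  filter_upwards [key, ha.integrable, hb.integrable] with ω h1 h2 h3 t ht
  exact norm_le_of_integral_le hε h2 h3 ht (ha.leftCont ω t ht) (hb.leftCont ω t ht) h1

theorem Conv.of_approx [IsFiniteMeasure P] {f : ℕ → Ω → ℝ → F} {fk : ℕ → ℕ → Ω → ℝ → F}
    {d : ℝ → Ω → F} {dk : ℕ → ℝ → Ω → F} {g : ℕ → Ω → ℝ → ℝ} {b : ℝ → Ω → ℝ} {ε : ℕ → ℝ}
    (hε : Tendsto ε atTop (𝓝 0)) (hε0 : ∀ k, 0 ≤ ε k) (hfk : ∀ k, X.Conv P (fk k) (dk k))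
    (hdk : ∀ k, X.IsDensity P (dk k)) (hd : X.IsDensity P d) (hg : X.Conv P g b)
    (hb : X.IsDensity P b) (hf : ∀ k, Dom (ε k) (fun n ω t => f n ω t - fk k n ω t) g)
    (h : ∀ k, ∀ᵐ ω ∂P, ∀ t ∈ Ioc 0 X.T, ‖dk k t ω - d t ω‖ ≤ ε k * b t ω) : X.Conv P f d := by
  intro t ht
  refine tendstoInMeasure_of_approx hε hε0 (fun k => hfk k t ht) (hg t ht)
    (hb.aemeasurable_integral ht) (fun k n ω => (hf k).le n ω t) fun k => ?_
  have ht' := Ioc_subset_Icc_self ht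
  filter_upwards [h k, (hdk k).integrable, hd.integrable, hb.integrable] with ω h1 h2 h3 h4
  rw [← intervalIntegral.integral_sub (intervalIntegrable_of_mem_Icc h2 ht')
    (intervalIntegrable_of_mem_Icc h3 ht'), ← intervalIntegral.integral_const_mul]
  exact intervalIntegral.norm_integral_le_of_norm_le ht.1.le
    (.of_forall fun s hs => h1 s ⟨hs.1, hs.2.trans ht.2⟩)
    ((intervalIntegrable_of_mem_Icc h4 ht').const_mul _)

variable [BorelSpace F] [SecondCountableTopology F]

theorem Conv.sum {ι : Type*} (s : Finset ι) {f : ι → ℕ → Ω → ℝ → F} {a : ι → ℝ → Ω → F}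
    (h : ∀ i ∈ s, X.Conv P (f i) (a i)) (ha : ∀ i ∈ s, X.IsDensity P (a i)) :
    X.Conv P (fun n ω t => ∑ i ∈ s, f i n ω t) (fun t ω => ∑ i ∈ s, a i t ω) := by
  classical
  induction s using Finset.induction_on with
  | empty => simpa using conv_zero
  | insert i s hi ih =>
    simp only [Finset.sum_insert hi]
    have hs := fun j hj => Finset.mem_insert_of_mem (s := s) (b := i) (a := j) hj
    exact (h i (Finset.mem_insert_self _ _)).add (ih (fun j hj => h j (hs j hj))
      (fun j hj => ha j (hs j hj))) (ha i (Finset.mem_insert_self _ _))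
      (IsDensity.sum s fun j hj => ha j (hs j hj))

variable [CompleteSpace F]

/-- The difference of the densities belongs to the zero process, which the zero process dominates
with constant `0`. -/
theorem Conv.ae_unique {f : ℕ → Ω → ℝ → F} {a a' : ℝ → Ω → F} (h : X.Conv P f a)
    (h' : X.Conv P f a') (ha : X.IsDensity P a) (ha' : X.IsDensity P a') :
    ∀ᵐ ω ∂P, ∀ t ∈ Ioc 0 X.T, a t ω = a' t ω := by
  have h0 := h.sub h' ha ha'
  simp only [sub_self] at h0
  have := h0.ae_norm_le (ha.sub ha') (conv_zero (X := X) (P := P) (F := ℝ)) isDensity_zero le_rfl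
    (dom_zero _)
  filter_upwards [this] with ω hω t ht
  simpa [sub_eq_zero] using hω t ht

/-- A process that is approximated by processes with limiting densities has a limiting density. -/
theorem exists_isDensity_conv_of_approx [IsFiniteMeasure P] {f : ℕ → Ω → ℝ → F}
    {fk : ℕ → ℕ → Ω → ℝ → F} {dk : ℕ → ℝ → Ω → F} {g : ℕ → Ω → ℝ → ℝ} {b : ℝ → Ω → ℝ} {ε : ℕ → ℝ}
    (hε : Tendsto ε atTop (𝓝 0)) (hε0 : ∀ k, 0 ≤ ε k) (hfk : ∀ k, X.Conv P (fk k) (dk k))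
    (hdk : ∀ k, X.IsDensity P (dk k)) (hg : X.Conv P g b) (hb : X.IsDensity P b)
    (hf : ∀ k, Dom (ε k) (fun n ω t => f n ω t - fk k n ω t) g) :
    ∃ d, X.IsDensity P d ∧ X.Conv P f d := by
  -- The unknown process `f` cancels in `(f - fk l) - (f - fk k)`, so the densities form a Cauchy
  -- sequence relative to `b`.
  have hdom : ∀ kl : ℕ × ℕ, ∀ᵐ ω ∂P, ∀ t ∈ Ioc 0 X.T,
      ‖dk kl.1 t ω - dk kl.2 t ω‖ ≤ (ε kl.2 + ε kl.1) * b t ω := by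
    intro kl
    refine ((hfk kl.1).sub (hfk kl.2) (hdk _) (hdk _)).ae_norm_le ((hdk _).sub (hdk _)) hg hb
      (add_nonneg (hε0 _) (hε0 _)) ?_
    simpa only [sub_sub_sub_cancel_left] using (hf kl.2).sub (hf kl.1)
  obtain ⟨S, hS, hSae, hSd⟩ := exists_measurableSet_forall_norm_le
    (fun kl : ℕ × ℕ => (hdk kl.1).sub (hdk kl.2)) hb hdom
  -- Off `S`, and at time zero, the truncated sequence is constantly `0`; hence `limUnder` has the
  -- value `0` there instead of an unspecified one, which keeps the limit measurable and
  -- left-continuous.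
  have hlim : ∀ ω t, ω ∈ S → t ∈ Ioc 0 X.T →
      Tendsto (fun k => dk k t ω) atTop (𝓝 (limUnder atTop fun k => truncate S (dk k) t ω)) := by
    intro ω t hω ht
    simp only [truncate_of_mem hω ht.1]
    refine CauchySeq.tendsto_limUnder (cauchySeq_iff_tendsto_dist_atTop_0.2 ?_)
    have h0 : Tendsto (fun p : ℕ × ℕ => (ε p.2 + ε p.1) * b t ω) atTop (𝓝 0) := by
      rw [← prod_atTop_atTop_eq]
      simpa using ((hε.comp tendsto_snd).add (hε.comp tendsto_fst)).mul_const (b t ω)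
    refine squeeze_zero (fun _ => dist_nonneg) (fun p => ?_) h0
    rw [dist_eq_norm]
    exact hSd ω hω p t ht
  have happ : ∀ k ω, ω ∈ S → ∀ t ∈ Ioc 0 X.T,
      ‖dk k t ω - limUnder atTop (fun k => truncate S (dk k) t ω)‖ ≤ ε k * b t ω := by
    intro k ω hω t ht
    refine le_of_tendsto_of_tendsto ((hlim ω t hω ht).const_sub _).norm
      ((hε.add_const (ε k)).mul_const (b t ω)) (.of_forall fun l => hSd ω hω (k, l) t ht) |>.trans ?_
    simp
  have hd : X.IsDensity P (fun t ω => limUnder atTop (fun k => truncate S (dk k) t ω)) := by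
    refine IsDensity.of_approx (fun k => (hdk k).truncate hS) (hb.truncate hS) hε ?_ ?_
    · intro k ω t ht
      by_cases hω : ω ∈ S
      · simpa only [truncate_of_mem hω ht.1] using happ k ω hω t ht
      · have hn : ¬ (ω ∈ S ∧ 0 < t) := fun h => hω h.1
        simp only [truncate_of_not hn, tendsto_const_nhds.limUnder_eq, sub_zero, norm_zero,
          mul_zero, le_refl]
    · have hn : ∀ ω, ¬ (ω ∈ S ∧ (0 : ℝ) < 0) := by simp
      simp only [truncate_of_not (hn _), tendsto_const_nhds.limUnder_eq]
      exact measurable_const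
  refine ⟨_, hd, Conv.of_approx hε hε0 hfk hdk hd hg hb hf fun k => ?_⟩
  filter_upwards [hSae] with ω hω using happ k ω hω

end Measurable

end SamplingScheme

/-! ### Power series in `z²` with bounded coefficients -/

theorem hasSum_norm_even_pow {𝕜 : Type*} [NormedField 𝕜] {z : 𝕜} (hz : ‖z‖ < 1) (k : ℕ) :
    HasSum (fun p : ℕ => ‖z ^ (2 * (p + k))‖) ((‖z‖ ^ 2) ^ k * (1 - ‖z‖ ^ 2)⁻¹) := by
  have h : ‖z‖ ^ 2 < 1 := pow_lt_one₀ (norm_nonneg _) hz two_ne_zero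
  have he : (fun p : ℕ => ‖z ^ (2 * (p + k))‖) = fun p => (‖z‖ ^ 2) ^ k * (‖z‖ ^ 2) ^ p := by
    ext p
    rw [norm_pow, pow_mul, pow_add, mul_comm]
  rw [he]
  exact (hasSum_geometric_of_lt_one (by positivity) h).mul_left _

theorem summable_norm_even_pow {𝕜 : Type*} [NormedField 𝕜] {z : 𝕜} (hz : ‖z‖ < 1) :
    Summable (fun p : ℕ => ‖z ^ (2 * p)‖) :=
  (hasSum_norm_even_pow hz 0).summable

theorem tendsto_tail_even_pow {x : ℝ} (h0 : 0 ≤ x) (hx : x < 1) :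
    Tendsto (fun k : ℕ => (x ^ 2) ^ k * (1 - x ^ 2)⁻¹) atTop (𝓝 0) := by
  have h := (tendsto_pow_atTop_nhds_zero_of_lt_one (by positivity)
    (pow_lt_one₀ h0 hx two_ne_zero)).mul_const (1 - x ^ 2)⁻¹
  simpa using h

/-- Weierstrass' test on each smaller ball of radius `r < 1`. -/
theorem continuousOn_tsum_even_pow {v : ℕ → ℝ} {g : ℝ} (hv : ∀ p, |v p| ≤ g) :
    ContinuousOn (fun z : ℂ => ∑' p, v p • z ^ (2 * p)) (Metric.ball 0 1) := by
  intro z hz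
  rw [mem_ball_zero_iff] at hz
  obtain ⟨r, hr, hr1⟩ := exists_between hz
  have hr0 : 0 ≤ r := (norm_nonneg _).trans hr.le
  have hc : ContinuousOn (fun z : ℂ => ∑' p, v p • z ^ (2 * p)) (Metric.ball 0 r) := by
    refine continuousOn_tsum (u := fun p => g * (r ^ 2) ^ p) (fun p => by fun_prop)
      ((summable_geometric_of_lt_one (by positivity)
        (pow_lt_one₀ hr0 hr1 two_ne_zero)).mul_left g) fun p w hw => ?_
    rw [mem_ball_zero_iff] at hw
    rw [norm_smul, norm_pow, Real.norm_eq_abs, ← pow_mul]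
    exact mul_le_mul (hv p) (pow_le_pow_left₀ (norm_nonneg _) hw.le _) (by positivity)
      ((abs_nonneg _).trans (hv p))
  exact (hc.continuousAt (Metric.isOpen_ball.mem_nhds (by simpa using hr))).continuousWithinAt

theorem summable_smul_of_bounded {F : Type*} [NormedAddCommGroup F] [NormedSpace ℝ F]
    [CompleteSpace F] {v : ℕ → ℝ} {g : ℝ} (hv : ∀ p, |v p| ≤ g) {c : ℕ → F}
    (hc : Summable fun p => ‖c p‖) : Summable (fun p => v p • c p) := by
  refine Summable.of_norm_bounded (hc.mul_left g) fun p => ?_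
  rw [norm_smul]
  exact mul_le_mul_of_nonneg_right (hv p) (norm_nonneg _)

theorem norm_tsum_sub_sum_le {v : ℕ → ℝ} {g : ℝ} (hv : ∀ p, |v p| ≤ g) {z : ℂ} (hz : ‖z‖ < 1)
    (k : ℕ) : ‖∑ p ∈ Finset.range k, v p • z ^ (2 * p) - ∑' p, v p • z ^ (2 * p)‖ ≤
      (‖z‖ ^ 2) ^ k * (1 - ‖z‖ ^ 2)⁻¹ * g := by
  have hs : Summable (fun p => v p • z ^ (2 * p)) :=
    summable_smul_of_bounded hv (c := fun p => z ^ (2 * p)) (summable_norm_even_pow hz)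
  rw [← hs.sum_add_tsum_nat_add k,
    sub_add_cancel_left, norm_neg]
  refine tsum_of_norm_bounded ((hasSum_norm_even_pow hz k).mul_right g) fun p => ?_
  rw [norm_smul, mul_comm]
  exact mul_le_mul_of_nonneg_left (hv _) (norm_nonneg _)

/-! ### Passing between power series and coefficients -/

namespace SamplingScheme

variable {Ω : Type*} [mΩ : MeasurableSpace Ω] {X : SamplingScheme Ω} {P : Measure Ω}

/-- The power series in `z ^ 2` with coefficients `U p`. -/
def powerSeries {Ω : Type*} (U : ℕ → ℕ → Ω → ℝ → ℝ) (z : ℂ) (n : ℕ) (ω : Ω) (t : ℝ) : ℂ :=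
  ∑' p, U p n ω t • z ^ (2 * p)

variable {U : ℕ → ℕ → Ω → ℝ → ℝ}

theorem tsum_ofReal_pow (v : ℕ → ℝ) (r : ℝ) :
    (∑' p, v p • (r : ℂ) ^ (2 * p)).re = ∑' p, v p • r ^ (2 * p) := by
  rw [← Complex.ofReal_re (∑' p, v p • r ^ (2 * p)), Complex.ofReal_tsum]
  simp

theorem IsDensity.smul_const {a : ℝ → Ω → ℝ} (ha : X.IsDensity P a) (c : ℂ) :
    X.IsDensity P (fun t ω => a t ω • c) := by
  simpa using ha.map ((ContinuousLinearMap.id ℝ ℝ).smulRight c)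

theorem Conv.smul_const {f : ℕ → Ω → ℝ → ℝ} {a : ℝ → Ω → ℝ} (h : X.Conv P f a)
    (ha : X.IsDensity P a) (c : ℂ) :
    X.Conv P (fun n ω t => f n ω t • c) (fun t ω => a t ω • c) := by
  simpa using h.map ((ContinuousLinearMap.id ℝ ℝ).smulRight c) ha

/-- If the power series have limiting densities for small real arguments, so do the
coefficients. -/
theorem exists_isDensity_coeff [IsFiniteMeasure P] (hU : ∀ p, Dom 1 (U p) (U 0))
    {a₀ : ℝ → Ω → ℝ} (ha₀ : X.IsDensity P a₀) (hc₀ : X.Conv P (U 0) a₀) {η : ℝ} (hη : 0 < η)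
    (hη1 : η ≤ 1) {α : ℝ → ℝ → Ω → ℝ} (hα : ∀ r ∈ Ioo 0 η, X.IsDensity P (α r))
    (hc : ∀ r ∈ Ioo 0 η, X.Conv P (fun n ω t => ∑' p, U p n ω t • r ^ (2 * p)) (α r)) (q : ℕ) :
    ∃ d, X.IsDensity P d ∧ X.Conv P (U q) d := by
  -- Once the coefficients below `q` have densities, so has the series minus its first `q` terms,
  -- divided by `z^{2q}`. This differs from `U q` by at most `z² / (1 - z²)` times `U 0`, which
  -- vanishes as `z → 0`.
  induction q using Nat.strong_induction_on with
  | _ q ih =>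
  choose! a ha hca using ih
  -- The shift by `2` gives `z k < η` already for `k = 0`.
  let z : ℕ → ℝ := fun k => η / (k + 2)
  have hz0 : ∀ k, 0 < z k := fun k => by positivity
  have hzη : ∀ k, z k < η := fun k => by
    rw [div_lt_iff₀ (by positivity)]
    nlinarith [Nat.cast_nonneg (α := ℝ) k]
  have hz1 : ∀ k, ‖z k‖ < 1 := fun k => by
    rw [Real.norm_of_nonneg (hz0 k).le]
    exact (hzη k).trans_le hη1
  have hzlim : Tendsto z atTop (𝓝 0) := by
    refine Tendsto.div_atTop tendsto_const_nhds ?_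
    exact tendsto_atTop_add_const_right _ _ tendsto_natCast_atTop_atTop
  have hzlim2 : Tendsto (fun k => ‖z k‖ ^ 2) atTop (𝓝 0) := by simpa using hzlim.norm.pow 2
  have hεlim : Tendsto (fun k => (‖z k‖ ^ 2) ^ 1 * (1 - ‖z k‖ ^ 2)⁻¹) atTop (𝓝 0) := by
    have := (hzlim2.pow 1).mul ((hzlim2.const_sub 1).inv₀ (by norm_num))
    simpa using this
  let e : ∀ k, ℝ →L[ℝ] ℝ := fun k => ((z k) ^ (2 * q))⁻¹ • ContinuousLinearMap.id ℝ ℝ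
  have hdS : ∀ k, X.IsDensity P (fun t ω => ∑ p ∈ Finset.range q, z k ^ (2 * p) * a p t ω) :=
    fun k => IsDensity.sum _ fun p hp =>
      (ha p (Finset.mem_range.1 hp)).map ((z k) ^ (2 * p) • ContinuousLinearMap.id ℝ ℝ)
  have hcS : ∀ k, X.Conv P (fun n ω t => ∑ p ∈ Finset.range q, z k ^ (2 * p) * U p n ω t)
      (fun t ω => ∑ p ∈ Finset.range q, z k ^ (2 * p) * a p t ω) :=
    fun k => Conv.sum _ (fun p hp => (hca p (Finset.mem_range.1 hp)).map
        ((z k) ^ (2 * p) • ContinuousLinearMap.id ℝ ℝ) (ha p (Finset.mem_range.1 hp)))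
      fun p hp => (ha p (Finset.mem_range.1 hp)).map ((z k) ^ (2 * p) • ContinuousLinearMap.id ℝ ℝ)
  have hα' := fun k => hα (z k) ⟨hz0 k, hzη k⟩
  have hc' := fun k => hc (z k) ⟨hz0 k, hzη k⟩
  refine exists_isDensity_conv_of_approx hεlim (fun k => ?_)
    (fun k => ((hc' k).sub (hcS k) (hα' k) (hdS k)).map (e k) ((hα' k).sub (hdS k)))
    (fun k => ((hα' k).sub (hdS k)).map (e k)) hc₀ ha₀ fun k => ?_
  · have : ‖z k‖ ^ 2 < 1 := pow_lt_one₀ (norm_nonneg _) (hz1 k) two_ne_zero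
    have : 0 < 1 - ‖z k‖ ^ 2 := by linarith
    positivity
  · have hs := (hasSum_norm_even_pow (hz1 k) 1)
    -- The error `U q` minus its approximation is the tail with the opposite sign.
    simp only [← norm_neg (z k ^ (2 * _))] at hs
    have hD := Dom.tsum (V := fun p => U (p + (q + 1))) (c := fun p => -(z k ^ (2 * (p + 1))))
      (fun p => hU _) hs.summable
    rw [hs.tsum_eq] at hD
    convert hD using 4 with n ω t
    have hsm : Summable (fun p => U p n ω t • z k ^ (2 * p)) :=
      summable_smul hU (c := fun p => z k ^ (2 * p)) (summable_norm_even_pow (hz1 k)) n ω t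
    rw [← hsm.sum_add_tsum_nat_add (q + 1),
      Finset.sum_range_succ]
    have hz := (pow_pos (hz0 k) (2 * q)).ne'
    have ht : ∑' p, U (p + (q + 1)) n ω t • z k ^ (2 * (p + (q + 1))) =
        - (z k ^ (2 * q) * ∑' p, U (p + (q + 1)) n ω t • -z k ^ (2 * (p + 1))) := by
      rw [← tsum_mul_left, ← tsum_neg]
      refine tsum_congr fun p => ?_
      simp only [smul_eq_mul]
      ring
    rw [ht]
    simp only [e, smul_apply, ContinuousLinearMap.id_apply, smul_eq_mul]
    have hcomm : ∑ p ∈ Finset.range q, U p n ω t * z k ^ (2 * p) =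
        ∑ p ∈ Finset.range q, z k ^ (2 * p) * U p n ω t :=
      Finset.sum_congr rfl fun _ _ => mul_comm _ _
    rw [hcomm]
    field_simp
    ring

theorem ae_abs_le {a : ℕ → ℝ → Ω → ℝ} (hU : ∀ p, Dom 1 (U p) (U 0))
    (ha : ∀ p, X.IsDensity P (a p)) (hc : ∀ p, X.Conv P (U p) (a p)) (p : ℕ) :
    ∀ᵐ ω ∂P, ∀ t ∈ Ioc 0 X.T, |a p t ω| ≤ 1 * a 0 t ω :=
  (hc p).ae_norm_le (ha p) (hc 0) (ha 0) zero_le_one (hU p)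

/-- If the coefficients have limiting densities, so do the power series on the unit disc. -/
theorem exists_isDensity_powerSeries [IsFiniteMeasure P] {a : ℕ → ℝ → Ω → ℝ}
    (hU : ∀ p, Dom 1 (U p) (U 0)) (ha : ∀ p, X.IsDensity P (a p))
    (hc : ∀ p, X.Conv P (U p) (a p)) :
    ∃ α : ℂ → ℝ → Ω → ℂ, (∀ z, ‖z‖ < 1 → X.IsDensity P (α z)) ∧
      (∀ ω, ∀ t ∈ Icc 0 X.T, ContinuousOn (fun z => α z t ω) (Metric.ball 0 1)) ∧
      (∀ z, ‖z‖ < 1 → X.Conv P (powerSeries U z) (α z)) ∧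
      ∀ᵐ ω ∂P, ∀ t ∈ Ioc 0 X.T, (∀ p, |a p t ω| ≤ a 0 t ω) ∧
        ∀ z : ℂ, α z t ω = ∑' p, a p t ω • z ^ (2 * p) := by
  obtain ⟨S, hS, hSae, hSd⟩ := exists_measurableSet_forall_norm_le ha (ha 0) (ae_abs_le hU ha hc)
  -- The bound `|a p| ≤ a 0` holds only almost surely and for `t > 0`; after truncation it holds for
  -- every `ω` and every `t` in `[0, T]`, as the continuity in `z` must.
  let a' : ℕ → ℝ → Ω → ℝ := fun p => truncate S (a p)
  have ha' : ∀ p, X.IsDensity P (a' p) := fun p => (ha p).truncate hS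
  have hle : ∀ p, ∀ t ∈ Icc 0 X.T, ∀ ω, |a' p t ω| ≤ a' 0 t ω := by
    intro p t ht ω
    by_cases h : ω ∈ S ∧ 0 < t
    · simp only [a', truncate_of_mem h.1 h.2]
      simpa using hSd ω h.1 p t ⟨h.2, ht.2⟩
    · simp [a', truncate_of_not h]
  have hS' : ∀ᵐ ω ∂P, ∀ t ∈ Ioc 0 X.T, ∀ p, a p t ω = a' p t ω := by
    filter_upwards [hSae] with ω hω t ht p using (truncate_of_mem hω ht.1).symm
  have hc' : ∀ p, X.Conv P (U p) (a' p) := fun p => (hc p).congr <| by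
    filter_upwards [hS'] with ω hω t ht using hω t ht p
  have hd1 : ∀ (z : ℂ) p, X.IsDensity P (fun t ω => a' p t ω • z ^ (2 * p)) :=
    fun z p => (ha' p).smul_const _
  have hc1 : ∀ (z : ℂ) p, X.Conv P (fun n ω t => U p n ω t • z ^ (2 * p))
      (fun t ω => a' p t ω • z ^ (2 * p)) := fun z p => (hc' p).smul_const (ha' p) _
  have hdS : ∀ (z : ℂ) k, X.IsDensity P
      (fun t ω => ∑ p ∈ Finset.range k, a' p t ω • z ^ (2 * p)) := fun z k =>
    IsDensity.sum _ fun p _ => hd1 z p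
  have hcS : ∀ (z : ℂ) k, X.Conv P (fun n ω t => ∑ p ∈ Finset.range k, U p n ω t • z ^ (2 * p))
      (fun t ω => ∑ p ∈ Finset.range k, a' p t ω • z ^ (2 * p)) := fun z k =>
    Conv.sum _ (fun p _ => hc1 z p) (fun p _ => hd1 z p)
  have happ : ∀ z : ℂ, ‖z‖ < 1 → ∀ k ω, ∀ t ∈ Ioc 0 X.T,
      ‖∑ p ∈ Finset.range k, a' p t ω • z ^ (2 * p) - ∑' p, a' p t ω • z ^ (2 * p)‖ ≤
        (‖z‖ ^ 2) ^ k * (1 - ‖z‖ ^ 2)⁻¹ * a' 0 t ω := fun z hz k ω t ht =>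
    norm_tsum_sub_sum_le (fun p => hle p t (Ioc_subset_Icc_self ht) ω) hz k
  have hd : ∀ z : ℂ, ‖z‖ < 1 → X.IsDensity P (fun t ω => ∑' p, a' p t ω • z ^ (2 * p)) := by
    intro z hz
    refine IsDensity.of_approx (hdS z) (ha' 0) (tendsto_tail_even_pow (norm_nonneg _) hz)
      (happ z hz) ?_
    have hn : ∀ p ω, a' p 0 ω = 0 := fun p ω => truncate_of_not (by simp)
    simp only [hn, zero_smul, tsum_zero]
    exact measurable_const
  refine ⟨fun z t ω => ∑' p, a' p t ω • z ^ (2 * p), hd, fun ω t ht =>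
    continuousOn_tsum_even_pow fun p => hle p t ht ω, fun z hz => ?_, ?_⟩
  · refine Conv.of_approx (tendsto_tail_even_pow (norm_nonneg _) hz) (fun k => ?_) (hcS z)
      (hdS z) (hd z hz) (hc' 0) (ha' 0) (fun k => ?_) fun k => .of_forall fun ω => happ z hz k ω
    · have : ‖z‖ ^ 2 < 1 := pow_lt_one₀ (norm_nonneg _) hz two_ne_zero
      have : 0 < 1 - ‖z‖ ^ 2 := by linarith
      positivity
    · have hs := hasSum_norm_even_pow hz k
      have hD := Dom.tsum (V := fun p => U (p + k)) (c := fun p => z ^ (2 * (p + k)))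
        (fun p => hU _) hs.summable
      rw [hs.tsum_eq] at hD
      convert hD using 4 with n ω t
      have hsm : Summable (fun p => U p n ω t • z ^ (2 * p)) :=
        summable_smul hU (c := fun p => z ^ (2 * p)) (summable_norm_even_pow hz) n ω t
      rw [powerSeries, ← hsm.sum_add_tsum_nat_add k,
        add_sub_cancel_left]
  · filter_upwards [hS'] with ω hω t ht
    simp only [hω t ht]
    exact ⟨fun p => hle p t (Ioc_subset_Icc_self ht) ω, fun z => trivial⟩

/-- Any densities of the power series are the sums of the densities of the coefficients. -/
theorem ae_hasSum_of_conv [IsFiniteMeasure P] {a : ℕ → ℝ → Ω → ℝ}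
    (hU : ∀ p, Dom 1 (U p) (U 0)) (ha : ∀ p, X.IsDensity P (a p))
    (hc : ∀ p, X.Conv P (U p) (a p)) {η : ℝ} (hη : η ≤ 1) {β : ℂ → ℝ → Ω → ℂ}
    (hβ : ∀ z, ‖z‖ < η → X.IsDensity P (β z))
    (hβc : ∀ ω, ∀ t ∈ Icc 0 X.T, ContinuousOn (fun z => β z t ω) (Metric.ball 0 η))
    (hβl : ∀ z, ‖z‖ < η → X.Conv P (powerSeries U z) (β z)) :
    ∀ᵐ ω ∂P, ∀ t ∈ Ioc 0 X.T, ∀ z : ℂ, ‖z‖ < η →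
      HasSum (fun p => (a p t ω : ℂ) * z ^ (2 * p)) (β z t ω) := by
  obtain ⟨α, hα, hαc, hαl, hαs⟩ := exists_isDensity_powerSeries hU ha hc
  -- Uniqueness has an exceptional null set for each `z`; a countable dense set of `z` leaves a
  -- single one, and continuity in `z` covers the rest of the disc.
  have heq : ∀ᵐ ω ∂P, ∀ i : ℕ, ‖TopologicalSpace.denseSeq ℂ i‖ < η → ∀ t ∈ Ioc 0 X.T,
      α (TopologicalSpace.denseSeq ℂ i) t ω = β (TopologicalSpace.denseSeq ℂ i) t ω := by
    simp only [ae_all_iff]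
    intro i hi
    exact (hαl _ (hi.trans_le hη)).ae_unique (hβl _ hi) (hα _ (hi.trans_le hη)) (hβ _ hi)
  filter_upwards [heq, hαs] with ω h1 h2 t ht z hz
  have ht' := Ioc_subset_Icc_self ht
  have hE : EqOn (fun z => α z t ω) (fun z => β z t ω)
      (Metric.ball 0 η ∩ range (TopologicalSpace.denseSeq ℂ)) := by
    rintro _ ⟨hw, i, rfl⟩
    exact h1 i (by simpa using hw) t ht
  have := hE.of_subset_closure ((hαc ω t ht').mono (Metric.ball_subset_ball hη)) (hβc ω t ht')
    inter_subset_left ((TopologicalSpace.denseRange_denseSeq ℂ).open_subset_closure_inter Metric.isOpen_ball)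
    (by simpa using hz)
  rw [← show α z t ω = β z t ω from this, (h2 t ht).2 z]
  simpa only [Complex.real_smul] using (summable_smul_of_bounded (h2 t ht).1
    (c := fun p => z ^ (2 * p)) (summable_norm_even_pow (hz.trans_le hη))).hasSum

end SamplingScheme

/-! ### Nonnegative matrices with a subinvariant vector -/

section Matrix

variable {m n : Type*} [Fintype m] [Fintype n] [DecidableEq m] [DecidableEq n]

/-- A symmetric matrix with nonnegative entries and a subinvariant vector. -/
structure IsSubinvariant (A : Matrix m m ℝ) (u : m → ℝ) : Prop where
  nonneg : ∀ i j, 0 ≤ A i j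
  symm : A.transpose = A
  vec_nonneg : ∀ i, 0 ≤ u i
  le : ∀ i, ∑ j, A i j * u j ≤ u i
  zero : ∀ i, u i = 0 → ∀ j, A i j = 0

namespace IsSubinvariant

variable {A : Matrix m m ℝ} {u : m → ℝ}

theorem pow_nonneg (h : IsSubinvariant A u) (p : ℕ) (i j : m) : 0 ≤ (A ^ p) i j := by
  induction p generalizing i j with
  | zero =>
    rw [pow_zero, Matrix.one_apply]
    split_ifs <;> norm_num
  | succ p ih =>
    rw [pow_succ, Matrix.mul_apply]
    exact Finset.sum_nonneg fun k _ => mul_nonneg (ih i k) (h.nonneg k j)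

theorem pow_le (h : IsSubinvariant A u) (p : ℕ) (i : m) : ∑ j, (A ^ p) i j * u j ≤ u i := by
  induction p with
  | zero => simp [Matrix.one_apply]
  | succ p ih =>
    simp only [pow_succ, Matrix.mul_apply, Finset.sum_mul]
    rw [Finset.sum_comm]
    refine le_trans (Finset.sum_le_sum fun k _ => ?_) ih
    simp only [mul_assoc]
    rw [← Finset.mul_sum]
    exact mul_le_mul_of_nonneg_left (h.le k) (h.pow_nonneg p i k)

/-- Keep only the diagonal term of `pow_le` and divide by `u i`. If `u i = 0`, row `i` of `A`
vanishes, and with it that of every positive power. -/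
theorem pow_diag_le_one (h : IsSubinvariant A u) (p : ℕ) (i : m) : (A ^ p) i i ≤ 1 := by
  rcases (h.vec_nonneg i).eq_or_lt with h0 | h0
  · cases p with
    | zero => simp
    | succ p =>
      rw [pow_succ', Matrix.mul_apply]
      simp [h.zero i h0.symm]
  · have h1 : (A ^ p) i i * u i ≤ 1 * u i := by
      rw [one_mul]
      refine le_trans ?_ (h.pow_le p i)
      exact Finset.single_le_sum (f := fun j => (A ^ p) i j * u j)
        (fun j _ => mul_nonneg (h.pow_nonneg p i j) (h.vec_nonneg j)) (Finset.mem_univ i)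
    exact le_of_mul_le_mul_right h1 h0

/-- By symmetry the square of this entry is one of the nonnegative terms that make up the diagonal
entry `(A ^ (2 * p)) i i`. -/
theorem pow_le_one (h : IsSubinvariant A u) (p : ℕ) (i j : m) : (A ^ p) i j ≤ 1 := by
  have hs : (A ^ p) j i = (A ^ p) i j := by
    conv_lhs => rw [← h.symm, ← Matrix.transpose_pow, Matrix.transpose_apply]
  have h1 := h.pow_diag_le_one (p + p) i
  rw [pow_add, Matrix.mul_apply] at h1
  have h2 := Finset.single_le_sum (f := fun j => (A ^ p) i j * (A ^ p) j i)
    (fun j _ => mul_nonneg (h.pow_nonneg p i j) (h.pow_nonneg p j i)) (Finset.mem_univ j)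
  simp only [hs] at h2
  nlinarith

/-- Entries of the powers bounded by `1` give a geometric majorant entry by entry, without any
spectral estimate. -/
theorem summable_pow (h : IsSubinvariant A u) {z : ℂ} (hz : ‖z‖ < 1) :
    Summable (fun p : ℕ => (z • A.map Complex.ofReal) ^ p) := by
  refine Pi.summable.2 fun i => Pi.summable.2 fun j => ?_
  refine Summable.of_norm_bounded (summable_geometric_of_lt_one (norm_nonneg z) hz) fun p => ?_
  have hp : (A.map Complex.ofReal) ^ p = (A ^ p).map Complex.ofReal :=
    (map_pow (Complex.ofRealHom.mapMatrix) A p).symm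
  rw [smul_pow, hp, Matrix.smul_apply, Matrix.map_apply, smul_eq_mul, norm_mul, norm_pow,
    Complex.norm_real, Real.norm_of_nonneg (h.pow_nonneg p i j)]
  exact mul_le_of_le_one_right (by positivity) (h.pow_le_one p i j)

end IsSubinvariant

theorem isSubinvariant_mul_transpose {m n : Type*} [Fintype m] [Fintype n] {G : Matrix m n ℝ} {u : m → ℝ} {v : n → ℝ}
    (hG : ∀ i j, 0 ≤ G i j) (hu : ∀ i, 0 ≤ u i) (h1 : ∀ i, ∑ j, G i j * v j ≤ u i)
    (h2 : ∀ j, ∑ i, G i j * u i ≤ v j) (h0 : ∀ i, u i = 0 → ∀ j, G i j = 0) :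
    IsSubinvariant (G * G.transpose) u where
  nonneg i j := by
    rw [Matrix.mul_apply]
    exact Finset.sum_nonneg fun k _ => mul_nonneg (hG i k) (hG j k)
  symm := by rw [Matrix.transpose_mul, Matrix.transpose_transpose]
  vec_nonneg := hu
  le i := by
    simp only [Matrix.mul_apply, Finset.sum_mul]
    rw [Finset.sum_comm]
    refine le_trans (Finset.sum_le_sum fun k _ => ?_) (h1 i)
    simp only [mul_assoc]
    rw [← Finset.mul_sum]
    exact mul_le_mul_of_nonneg_left (h2 k) (hG i k)
  zero i hi j := by simp [Matrix.mul_apply, h0 i hi]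

/-- Block inversion by means of left inverses of the Schur complements. -/
theorem inv_one_add_fromBlocks {𝕜 : Type*} [Field 𝕜] (L : Matrix m n 𝕜) {R : Matrix m m 𝕜}
    {R' : Matrix n n 𝕜} (hR : R * (1 - L * L.transpose) = 1)
    (hR' : R' * (1 - L.transpose * L) = 1) :
    (1 + Matrix.fromBlocks 0 L L.transpose 0)⁻¹ =
      Matrix.fromBlocks R (-(R * L)) (-(R' * L.transpose)) R' := by
  refine Matrix.inv_eq_left_inv ?_
  rw [← Matrix.fromBlocks_one, Matrix.fromBlocks_add, Matrix.fromBlocks_multiply]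
  have e1 : R - R * L * L.transpose = 1 := by rw [← hR, Matrix.mul_sub, Matrix.mul_assoc]; simp
  have e2 : R' - R' * L.transpose * L = 1 := by rw [← hR', Matrix.mul_sub, Matrix.mul_assoc]; simp
  simp only [add_zero, zero_add, Matrix.mul_one, Matrix.neg_mul]
  rw [← sub_eq_add_neg, e1, neg_add_eq_sub (R' * _ * L), e2, neg_add_cancel, add_neg_cancel]

end Matrix

/-! ### The matrix `G` and its diagonal sums -/

namespace Obs

variable {T : ℝ} {N₁ N₂ : ℝ → ℕ}

theorem G_nonneg (i j) : 0 ≤ G T N₁ N₂ i j := by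
  simp only [G, Matrix.of_apply]
  positivity

theorem G_transpose : (G T N₁ N₂).transpose = G T N₂ N₁ := by
  ext i j
  simp only [G, Matrix.of_apply, Matrix.transpose_apply]
  rw [inter_comm, mul_comm]

theorem sum_measureReal_inter_interval_le (hT : 0 < T) (a b : ℝ) :
    ∑ j, volume.real (Icc a b ∩ interval T N₂ j) ≤ volume.real (Icc a b) := by
  -- Neighbouring closed intervals share an end point; the half-open ones are disjoint and differ
  -- from them by null sets.
  have h1 : ∀ j : Fin (count T N₂), volume.real (Icc a b ∩ interval T N₂ j) =
      volume.real (Icc a b ∩ Ioc (time T N₂ j) (time T N₂ ((j : ℕ) + 1))) := fun j =>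
    measureReal_congr ((ae_eq_refl _).inter Ioc_ae_eq_Icc.symm)
  have hdisj : Pairwise (Function.onFun Disjoint fun j : ℕ =>
      Ioc (time T N₂ j) (time T N₂ (j + 1))) := (time_mono hT).pairwise_disjoint_on_Ioc_succ
  simp only [h1]
  have hfin : ∀ s ⊆ Icc a b, volume s ≠ ⊤ := fun s hs =>
    ((measure_mono hs).trans_lt isCompact_Icc.measure_lt_top).ne
  rw [← measureReal_biUnion_finset _ _ fun j _ => hfin _ inter_subset_left]
  · exact measureReal_mono (by simp [iUnion_subset_iff]) (hfin _ subset_rfl)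
  · intro j _ k _ hjk
    exact (hdisj (fun h => hjk (Fin.ext h))).mono inter_subset_right inter_subset_right
  · exact fun j _ => measurableSet_Icc.inter measurableSet_Ioc

/-- Multiplication by `√|J|` turns `G` into `|I ∩ J| / √|I|`, and the overlaps add up to at most
`|I|`. -/
theorem sum_G_mul_le (hT : 0 < T) (i) :
    ∑ j, G T N₁ N₂ i j * √(volume.real (interval T N₂ j)) ≤
      √(volume.real (interval T N₁ i)) := by
  have h1 : ∀ j, G T N₁ N₂ i j * √(volume.real (interval T N₂ j)) ≤
      volume.real (interval T N₁ i ∩ interval T N₂ j) / √(volume.real (interval T N₁ i)) := by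
    intro j
    simp only [G, Matrix.of_apply]
    rcases eq_or_ne √(volume.real (interval T N₂ j)) 0 with h | h
    · rw [h, mul_zero]; positivity
    · rw [div_mul_eq_mul_div, mul_div_mul_right _ _ h]
  refine (Finset.sum_le_sum fun j _ => h1 j).trans ?_
  rw [← Finset.sum_div]
  refine (div_le_div_of_nonneg_right (sum_measureReal_inter_interval_le hT _ _)
    (Real.sqrt_nonneg _)).trans ?_
  rw [← interval, Real.div_sqrt]

theorem isSubinvariant (hT : 0 < T) (N₁ N₂ : ℝ → ℕ) :
    IsSubinvariant (G T N₁ N₂ * (G T N₁ N₂).transpose)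
      (fun i => √(volume.real (interval T N₁ i))) := by
  refine isSubinvariant_mul_transpose (v := fun j => √(volume.real (interval T N₂ j))) G_nonneg
    (fun _ => Real.sqrt_nonneg _) (sum_G_mul_le hT) (fun j => ?_) fun i hi j => ?_
  · have := sum_G_mul_le (N₁ := N₂) (N₂ := N₁) hT j
    rw [← G_transpose] at this
    exact this
  · simp only [G, Matrix.of_apply, hi, zero_mul, div_zero]

/-- The sum of the diagonal elements of `(G Gᵀ) ^ p` that belong to intervals starting before
`t`. -/
def diagSum (T : ℝ) (N₁ N₂ : ℝ → ℕ) (p : ℕ) (t : ℝ) : ℝ :=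
  ∑ i : Fin (count T N₁), if time T N₁ i ≤ t then ((G T N₁ N₂ * (G T N₁ N₂).transpose) ^ p) i i else 0

theorem abs_diagSum_le (hT : 0 < T) (p : ℕ) (t : ℝ) :
    |diagSum T N₁ N₂ p t| ≤ diagSum T N₁ N₂ 0 t := by
  refine (Finset.abs_sum_le_sum_abs _ _).trans (Finset.sum_le_sum fun i _ => ?_)
  have h0 := (isSubinvariant hT N₁ N₂).pow_nonneg p i i
  have h1 := (isSubinvariant hT N₁ N₂).pow_diag_le_one p i
  split_ifs
  · simpa [abs_of_nonneg h0] using h1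
  · simp

theorem abs_diagSum_sub_le (hT : 0 < T) (p : ℕ) {s t : ℝ} (hst : s ≤ t) :
    |diagSum T N₁ N₂ p t - diagSum T N₁ N₂ p s| ≤
      diagSum T N₁ N₂ 0 t - diagSum T N₁ N₂ 0 s := by
  rw [diagSum, diagSum, diagSum, diagSum, ← Finset.sum_sub_distrib, ← Finset.sum_sub_distrib]
  refine (Finset.abs_sum_le_sum_abs _ _).trans (Finset.sum_le_sum fun i _ => ?_)
  have h0 := (isSubinvariant hT N₁ N₂).pow_nonneg p i i
  have h1 := (isSubinvariant hT N₁ N₂).pow_diag_le_one p i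
  split_ifs with h2 h3 h3
  · simp
  · simpa [abs_of_nonneg h0] using h1
  · exact absurd (h3.trans hst) h2
  · simp

theorem time_lt_of_G_ne_zero {i j} (h : G T N₁ N₂ i j ≠ 0) :
    time T N₁ i < time T N₂ ((j : ℕ) + 1) := by
  by_contra! hc
  refine h ?_
  have : volume.real (interval T N₁ i ∩ interval T N₂ j) = 0 := by
    rw [interval, interval, Icc_inter_Icc, Real.volume_real_Icc]
    refine max_eq_right (sub_nonpos.2 ?_)
    exact (min_le_right _ _).trans (hc.trans (le_max_left _ _))
  simp only [G, Matrix.of_apply, this, zero_div]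

/-- The indicator of the intervals straddling `t`. -/
def straddle (T : ℝ) (N : ℝ → ℕ) (t : ℝ) (i : ℕ) : ℝ :=
  if time T N i ≤ t ∧ t < time T N (i + 1) then 1 else 0

theorem straddle_nonneg (T : ℝ) (N : ℝ → ℕ) (t : ℝ) (i : ℕ) : 0 ≤ straddle T N t i := by
  unfold straddle; split_ifs <;> norm_num

/-- At most one interval of a partition straddles `t`. -/
theorem sum_straddle_mul_le (hT : 0 < T) {N : ℝ → ℕ} (t : ℝ) {k : ℕ} {x : Fin k → ℝ}
    (hx : ∀ i, x i ≤ 1) : ∑ i : Fin k, straddle T N t i * x i ≤ 1 := by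
  by_cases h : ∃ i : Fin k, time T N i ≤ t ∧ t < time T N (i + 1)
  · obtain ⟨i, hi⟩ := h
    rw [Finset.sum_eq_single i]
    · rw [straddle, if_pos hi, one_mul]; exact hx i
    · intro j _ hji
      rw [straddle, if_neg, zero_mul]
      rintro ⟨h1, h2⟩
      rcases lt_or_gt_of_ne (fun h => hji (Fin.ext h) : (j : ℕ) ≠ i) with h | h
      · exact absurd ((time_mono hT (Nat.succ_le_of_lt h)).trans hi.1) (not_le.2 h2)
      · exact absurd ((time_mono hT (Nat.succ_le_of_lt h)).trans h1) (not_le.2 hi.2)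
    · simp
  · refine le_trans (le_of_eq (Finset.sum_eq_zero fun i _ => ?_)) zero_le_one
    rw [straddle, if_neg (fun hi => h ⟨i, hi⟩), zero_mul]

/-- If one of two overlapping intervals starts by time `t` and the other later, the first has not
ended at `t`. -/
theorem abs_indicator_sub_le {t : ℝ} {i j} (h : G T N₁ N₂ i j ≠ 0) :
    |(if time T N₁ i ≤ t then (1 : ℝ) else 0) - if time T N₂ j ≤ t then 1 else 0| ≤
      straddle T N₁ t i + straddle T N₂ t j := by
  have h1 := time_lt_of_G_ne_zero h
  have h2 : time T N₂ j < time T N₁ ((i : ℕ) + 1) := by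
    refine time_lt_of_G_ne_zero (N₁ := N₂) (N₂ := N₁) (i := j) (j := i) ?_
    rwa [← G_transpose]
  have p1 := straddle_nonneg T N₁ t i
  have p2 := straddle_nonneg T N₂ t j
  by_cases k1 : time T N₁ i ≤ t <;> by_cases k2 : time T N₂ j ≤ t
  · simp only [k1, k2, if_true, sub_self, abs_zero]; linarith
  · have : straddle T N₁ t i = 1 := if_pos ⟨k1, (not_le.1 k2).trans h2⟩
    simp only [k1, k2, if_true, if_false, sub_zero, abs_one, this]; linarith
  · have : straddle T N₂ t j = 1 := if_pos ⟨k2, (not_le.1 k1).trans h1⟩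
    simp only [k1, k2, if_true, if_false, zero_sub, abs_neg, abs_one, this]; linarith
  · simp only [k1, k2, if_false, sub_self, abs_zero]; linarith

/-- With `B = Gᵀ (G Gᵀ)^p`, the two powers are `G B` and `B G`, so both sums run over the products
`G i j * B j i`, selected by the start of `I` or of `J`. The selections disagree only where `I` or
`J` straddles `t`; summing over the other index leaves one diagonal entry, at most `1`, for each
family. -/
theorem abs_diagSum_sub_diagSum_le (hT : 0 < T) (p : ℕ) (t : ℝ) :
    |diagSum T N₁ N₂ (p + 1) t - diagSum T N₂ N₁ (p + 1) t| ≤ 2 := by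
  set g := G T N₁ N₂ with hg
  have hgt : G T N₂ N₁ = g.transpose := G_transpose.symm
  set B := g.transpose * (g * g.transpose) ^ p with hB
  have hA := isSubinvariant hT N₁ N₂
  have hA' := isSubinvariant hT N₂ N₁
  have hpow : (g * g.transpose) ^ (p + 1) = g * B := by
    rw [hB, pow_succ', Matrix.mul_assoc]
  have hB2 : B = (g.transpose * g) ^ p * g.transpose := by
    rw [hB]
    clear_value g
    clear * -
    induction p with
    | zero => simp
    | succ p ih => rw [pow_succ, ← Matrix.mul_assoc, ih, pow_succ]; simp only [Matrix.mul_assoc]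
  have hpow' : (g.transpose * g) ^ (p + 1) = B * g := by
    rw [hB2, pow_succ, Matrix.mul_assoc]
  have hB0 : ∀ j i, 0 ≤ B j i := fun j i => by
    rw [hB, Matrix.mul_apply]
    exact Finset.sum_nonneg fun k _ => mul_nonneg (G_nonneg _ _) (hA.pow_nonneg p k i)
  have e1 : diagSum T N₁ N₂ (p + 1) t =
      ∑ i : Fin (count T N₁), ∑ j : Fin (count T N₂), (if time T N₁ i ≤ t then (1 : ℝ) else 0) * (g i j * B j i) := by
    rw [diagSum, ← hg, hpow]
    refine Finset.sum_congr rfl fun i _ => ?_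
    rw [← Finset.mul_sum, Matrix.mul_apply]
    split_ifs <;> simp
  have e2 : diagSum T N₂ N₁ (p + 1) t =
      ∑ i : Fin (count T N₁), ∑ j : Fin (count T N₂), (if time T N₂ j ≤ t then (1 : ℝ) else 0) * (g i j * B j i) := by
    rw [diagSum, hgt, Matrix.transpose_transpose, hpow', Finset.sum_comm]
    refine Finset.sum_congr rfl fun i _ => ?_
    rw [← Finset.mul_sum, Matrix.mul_apply]
    split_ifs <;> simp [mul_comm]
  have hs1 : ∑ i : Fin (count T N₁), ∑ j : Fin (count T N₂), straddle T N₁ t i * (g i j * B j i) ≤ 1 := by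
    simp only [← Finset.mul_sum, ← Matrix.mul_apply]
    rw [← hpow]
    exact sum_straddle_mul_le hT t fun i => hA.pow_diag_le_one (p + 1) i
  have hs2 : ∑ i : Fin (count T N₁), ∑ j : Fin (count T N₂), straddle T N₂ t j * (g i j * B j i) ≤ 1 := by
    rw [Finset.sum_comm]
    simp only [mul_comm (g _ _), ← Finset.mul_sum, ← Matrix.mul_apply]
    rw [← hpow']
    refine sum_straddle_mul_le hT t fun j => ?_
    have := hA'.pow_diag_le_one (p + 1) j
    rwa [hgt, Matrix.transpose_transpose] at this
  rw [e1, e2, ← Finset.sum_sub_distrib]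
  simp only [← Finset.sum_sub_distrib]
  have hle : ∀ (i : Fin (count T N₁)) (j : Fin (count T N₂)), |(if time T N₁ i ≤ t then (1 : ℝ) else 0) * (g i j * B j i) -
      (if time T N₂ j ≤ t then (1 : ℝ) else 0) * (g i j * B j i)| ≤
      straddle T N₁ t i * (g i j * B j i) + straddle T N₂ t j * (g i j * B j i) := by
    intro i j
    have h0 : 0 ≤ g i j * B j i := mul_nonneg (G_nonneg _ _) (hB0 j i)
    rw [← sub_mul, ← add_mul, abs_mul, abs_of_nonneg h0]
    by_cases hz : g i j = 0
    · simp [hz]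
    · exact mul_le_mul_of_nonneg_right (abs_indicator_sub_le hz) h0
  calc _ ≤ ∑ i : Fin (count T N₁), ∑ j : Fin (count T N₂), (straddle T N₁ t i * (g i j * B j i) + straddle T N₂ t j * (g i j * B j i)) :=
        (Finset.abs_sum_le_sum_abs _ _).trans (Finset.sum_le_sum fun i _ =>
          (Finset.abs_sum_le_sum_abs _ _).trans (Finset.sum_le_sum fun j _ => hle i j))
    _ ≤ 2 := by
        simp only [Finset.sum_add_distrib]
        linarith

end Obs

/-! ### Neumann series and the functional `A` -/

namespace Obs

variable {T : ℝ} {N N₁ N₂ : ℝ → ℕ}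

theorem E_eq_diagonal (hT : 0 < T) (t : ℝ) :
    E T N t = Matrix.diagonal fun i : Fin (count T N) => if time T N i ≤ t then (1 : ℂ) else 0 := by
  have h : ∀ i, (interval T N i ∩ Icc 0 t).Nonempty ↔ time T N i ≤ t := by
    refine fun i => ⟨fun ⟨x, hx, hx'⟩ => hx.1.trans hx'.2, fun h => ⟨time T N i, ?_, ?_⟩⟩
    · exact ⟨le_rfl, time_mono hT (Nat.le_succ _)⟩
    · exact ⟨time_nonneg hT _, h⟩
  simp only [E, h]

/-- The complex matrix `G Gᵀ`. -/
def gram (T : ℝ) (N₁ N₂ : ℝ → ℕ) : Matrix (Fin (count T N₁)) (Fin (count T N₁)) ℂ :=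
  (G T N₁ N₂ * (G T N₁ N₂).transpose).map Complex.ofReal

theorem map_mul_transpose : (G T N₁ N₂).map Complex.ofReal *
    ((G T N₁ N₂).map Complex.ofReal).transpose = gram T N₁ N₂ := by
  rw [gram, ← Matrix.transpose_map]
  exact (Matrix.map_mul (f := Complex.ofRealHom)).symm

theorem transpose_map_mul : ((G T N₁ N₂).map Complex.ofReal).transpose *
    (G T N₁ N₂).map Complex.ofReal = gram T N₂ N₁ := by
  rw [← map_mul_transpose, ← G_transpose, Matrix.transpose_map, Matrix.transpose_transpose]

theorem gram_transpose : (gram T N₁ N₂).transpose = gram T N₁ N₂ := by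
  rw [← map_mul_transpose, Matrix.transpose_mul, Matrix.transpose_transpose]

/-- The Neumann series for the inverse of `1 - z² G Gᵀ`. -/
def resolvent (T : ℝ) (N₁ N₂ : ℝ → ℕ) (z : ℂ) :
    Matrix (Fin (count T N₁)) (Fin (count T N₁)) ℂ :=
  ∑' p, (z ^ 2 • gram T N₁ N₂) ^ p

theorem summable_resolvent (hT : 0 < T) {z : ℂ} (hz : ‖z‖ < 1) :
    Summable fun p => (z ^ 2 • gram T N₁ N₂) ^ p :=
  (isSubinvariant hT N₁ N₂).summable_pow (by
    rw [norm_pow]; exact pow_lt_one₀ (norm_nonneg _) hz two_ne_zero)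

theorem resolvent_mul (hT : 0 < T) {z : ℂ} (hz : ‖z‖ < 1) :
    resolvent T N₁ N₂ z * (1 - z ^ 2 • gram T N₁ N₂) = 1 :=
  (summable_resolvent hT hz).tsum_pow_mul_one_sub

theorem trace_pow_mul_E (hT : 0 < T) (p : ℕ) (t : ℝ) :
    (gram T N₁ N₂ ^ p * E T N₁ t).trace = (diagSum T N₁ N₂ p t : ℂ) := by
  have hp : gram T N₁ N₂ ^ p =
      ((G T N₁ N₂ * (G T N₁ N₂).transpose) ^ p).map Complex.ofReal :=
    (map_pow (Complex.ofRealHom.mapMatrix) _ p).symm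
  rw [hp, E_eq_diagonal hT, Matrix.trace, diagSum, Complex.ofReal_sum]
  refine Finset.sum_congr rfl fun i _ => ?_
  rw [Matrix.diag_apply, Matrix.mul_diagonal, Matrix.map_apply]
  split_ifs <;> simp

theorem hasSum_trace_resolvent (hT : 0 < T) {z : ℂ} (hz : ‖z‖ < 1) (t : ℝ) :
    HasSum (fun p => diagSum T N₁ N₂ p t • z ^ (2 * p))
      (resolvent T N₁ N₂ z * E T N₁ t).trace := by
  have h := ((summable_resolvent (N₁ := N₁) (N₂ := N₂) hT hz).hasSum.mul_right
    (E T N₁ t)).map (Matrix.traceAddMonoidHom _ ℂ) continuous_id.matrix_trace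
  change HasSum _ (resolvent T N₁ N₂ z * E T N₁ t).trace at h
  convert h using 1
  ext p
  rw [Function.comp_apply, Matrix.traceAddMonoidHom_apply, smul_pow, Matrix.smul_mul, Matrix.trace_smul, trace_pow_mul_E hT, pow_mul,
    Complex.real_smul, smul_eq_mul, mul_comm]

/-- The resolvent identity `z² R G Gᵀ = R - 1`, which reduces the mixed term of `A` to the diagonal
one. -/
theorem sq_mul_trace_resolvent (hT : 0 < T) {z : ℂ} (hz : ‖z‖ < 1) (t : ℝ) :
    z ^ 2 * (resolvent T N₁ N₂ z * gram T N₁ N₂ * E T N₁ t).trace =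
      (resolvent T N₁ N₂ z * E T N₁ t).trace - (diagSum T N₁ N₂ 0 t : ℂ) := by
  have h := resolvent_mul (N₁ := N₁) (N₂ := N₂) hT hz
  rw [Matrix.mul_sub, Matrix.mul_one, Matrix.mul_smul, sub_eq_iff_eq_add] at h
  have h1 : z ^ 2 • (resolvent T N₁ N₂ z * gram T N₁ N₂) = resolvent T N₁ N₂ z - 1 :=
    eq_sub_of_add_eq' h.symm
  rw [← trace_pow_mul_E hT, pow_zero, ← smul_eq_mul, ← Matrix.trace_smul, ← Matrix.smul_mul, h1,
    Matrix.sub_mul, Matrix.trace_sub]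

theorem L_smul_one (z : ℂ) :
    L T N₁ N₂ (z • Matrix.of fun _ _ => 1) = z • (G T N₁ N₂).map Complex.ofReal := by
  ext i j
  simp [L]

theorem M_smul_one (hT : 0 < T) {z : ℂ} (hz : ‖z‖ < 1) :
    M T N₁ N₂ (z • Matrix.of fun _ _ => 1) =
      Matrix.fromBlocks (resolvent T N₁ N₂ z)
        (-(resolvent T N₁ N₂ z * z • (G T N₁ N₂).map Complex.ofReal))
        (-(resolvent T N₂ N₁ z * (z • (G T N₁ N₂).map Complex.ofReal).transpose))
        (resolvent T N₂ N₁ z) := by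
  rw [M, L_smul_one]
  refine inv_one_add_fromBlocks _ ?_ ?_
  · rw [Matrix.transpose_smul, Matrix.smul_mul, Matrix.mul_smul, smul_smul, ← sq,
      map_mul_transpose, resolvent_mul hT hz]
  · rw [Matrix.transpose_smul, Matrix.smul_mul, Matrix.mul_smul, smul_smul, ← sq,
      transpose_map_mul, resolvent_mul hT hz]

theorem A_smul_one (hT : 0 < T) {z : ℂ} (hz : ‖z‖ < 1) (x y w : ℂ) (t : ℝ) :
    A T N₁ N₂ (x • E T N₁ t) (y • E T N₂ t) (w • (E T N₁ t * (G T N₁ N₂).map Complex.ofReal))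
      (z • Matrix.of fun _ _ => 1) =
      x * (resolvent T N₁ N₂ z * E T N₁ t).trace + y * (resolvent T N₂ N₁ z * E T N₂ t).trace
        - 2 * w * (z * (resolvent T N₁ N₂ z * gram T N₁ N₂ * E T N₁ t).trace) := by
  have hE : (E T N₁ t).transpose = E T N₁ t := by
    rw [E_eq_diagonal hT, Matrix.diagonal_transpose]
  have hc : ((-(resolvent T N₁ N₂ z * z • (G T N₁ N₂).map Complex.ofReal)).transpose *
      (w • (E T N₁ t * (G T N₁ N₂).map Complex.ofReal))).trace =
      -(w * (z * (resolvent T N₁ N₂ z * gram T N₁ N₂ * E T N₁ t).trace)) := by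
    rw [Matrix.mul_smul, Matrix.trace_smul, Matrix.transpose_neg, Matrix.neg_mul,
      Matrix.trace_neg, Matrix.mul_smul, Matrix.transpose_smul, Matrix.smul_mul,
      Matrix.trace_smul, Matrix.transpose_mul, smul_eq_mul, smul_eq_mul, mul_neg]
    congr 3
    -- Cyclicity brings `G` and `Gᵀ` together; transposing the whole trace then turns the transposed
    -- resolvent back into the resolvent, so that its symmetry is not needed.
    rw [Matrix.mul_assoc, Matrix.trace_mul_comm, Matrix.mul_assoc, Matrix.mul_assoc,
      map_mul_transpose, ← Matrix.trace_transpose, Matrix.transpose_mul, Matrix.transpose_mul,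
      Matrix.transpose_transpose, gram_transpose, hE, Matrix.mul_assoc, Matrix.trace_mul_comm,
      Matrix.trace_mul_comm, Matrix.mul_assoc, Matrix.trace_mul_comm, Matrix.mul_assoc,
      Matrix.trace_mul_comm, Matrix.mul_assoc]
  rw [A, M_smul_one hT hz, Matrix.toBlocks_fromBlocks₁₁, Matrix.toBlocks_fromBlocks₁₂,
    Matrix.toBlocks_fromBlocks₂₂, hc, Matrix.mul_smul, Matrix.mul_smul, Matrix.trace_smul,
    Matrix.trace_smul, smul_eq_mul, smul_eq_mul]
  ring

end Obs

/-! ### The conditions in terms of masses and power series -/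

theorem setIntegral_sum_dirac {ι : Type*} [Fintype ι] {c x : ι → ℝ} (hc : ∀ i, 0 ≤ c i)
    (hx : ∀ i, 0 ≤ x i) {t T : ℝ} (ht : t ≤ T) :
    ∫ s in Icc 0 T, indicator (Icc 0 t) (1 : ℝ → ℝ) s
      ∂(∑ i, ENNReal.ofReal (c i) • Measure.dirac (x i)) = ∑ i, if x i ≤ t then c i else 0 := by
  rw [setIntegral_indicator measurableSet_Icc,
    inter_eq_right.2 (Icc_subset_Icc_right ht)]
  simp only [Pi.one_apply, setIntegral_const, smul_eq_mul, mul_one]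
  rw [Measure.real, Measure.finsetSum_apply, ENNReal.toReal_sum]
  · refine Finset.sum_congr rfl fun i _ => ?_
    rw [Measure.smul_apply, Measure.dirac_apply' _ measurableSet_Icc]
    by_cases h : x i ≤ t <;> simp [indicator, hx i, h, hc i]
  · intro i _
    rw [Measure.smul_apply, Measure.dirac_apply' _ measurableSet_Icc]
    by_cases h : x i ≤ t <;> simp [indicator, hx i, h]

namespace SamplingScheme

variable {Ω : Type*} [mΩ : MeasurableSpace Ω] (X : SamplingScheme Ω)

/-- The mass `ν_n^{p,1}([0, t])`. -/
def mass₁ (p n : ℕ) (ω : Ω) (t : ℝ) : ℝ :=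
  (X.b n)⁻¹ * Obs.diagSum X.T (X.path n 0 ω) (X.path n 1 ω) p t

/-- The mass `ν_n^{p,2}([0, t])`. -/
def mass₂ (p n : ℕ) (ω : Ω) (t : ℝ) : ℝ :=
  (X.b n)⁻¹ * Obs.diagSum X.T (X.path n 1 ω) (X.path n 0 ω) p t

theorem b_pos (n : ℕ) : 0 < X.b n := zero_lt_one.trans_le (X.one_le_b n)

theorem dom_mul_diagSum (N N' : ℕ → Ω → ℝ → ℕ) (p : ℕ) :
    Dom 1 (fun n ω t => (X.b n)⁻¹ * Obs.diagSum X.T (N n ω) (N' n ω) p t)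
      (fun n ω t => (X.b n)⁻¹ * Obs.diagSum X.T (N n ω) (N' n ω) 0 t) where
  le n ω t := by
    have hb := inv_nonneg.2 (X.b_pos n).le
    rw [one_mul, norm_mul, Real.norm_of_nonneg hb]
    exact mul_le_mul_of_nonneg_left (Obs.abs_diagSum_le X.T_pos p t) hb
  incr n ω s t hst := by
    have hb := inv_nonneg.2 (X.b_pos n).le
    rw [one_mul, ← mul_sub, ← mul_sub, norm_mul, Real.norm_of_nonneg hb]
    exact mul_le_mul_of_nonneg_left (Obs.abs_diagSum_sub_le X.T_pos p hst) hb

theorem dom_mass₁ (p : ℕ) : Dom 1 (X.mass₁ p) (X.mass₁ 0) :=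
  X.dom_mul_diagSum (fun n => X.path n 0) (fun n => X.path n 1) p

theorem dom_mass₂ (p : ℕ) : Dom 1 (X.mass₂ p) (X.mass₂ 0) :=
  X.dom_mul_diagSum (fun n => X.path n 1) (fun n => X.path n 0) p

theorem abs_mass₁_sub_mass₂_le (p n : ℕ) (ω : Ω) (t : ℝ) :
    |X.mass₁ (p + 1) n ω t - X.mass₂ (p + 1) n ω t| ≤ (X.b n)⁻¹ * 2 := by
  have hb := inv_nonneg.2 (X.b_pos n).le
  rw [mass₁, mass₂, ← mul_sub, abs_mul, abs_of_nonneg hb]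
  exact mul_le_mul_of_nonneg_left (Obs.abs_diagSum_sub_diagSum_le X.T_pos p t) hb

variable {X} {P : Measure Ω}

/-- Only positive powers qualify: for `p = 0` the masses count the intervals of two unrelated
partitions. -/
theorem conv_mass₁_iff_conv_mass₂ (p : ℕ) {a : ℝ → Ω → ℝ} :
    X.Conv P (X.mass₁ (p + 1)) a ↔ X.Conv P (X.mass₂ (p + 1)) a := by
  have h0 : Tendsto (fun n => (X.b n)⁻¹ * 2) atTop (𝓝 0) := by
    simpa using (tendsto_inv_atTop_zero.comp X.tendsto_b).mul_const 2
  constructor <;> intro h t ht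
  · exact tendstoInMeasure_of_dist_le (h t ht) h0
      fun n ω => X.abs_mass₁_sub_mass₂_le p n ω t
  · refine tendstoInMeasure_of_dist_le (h t ht) h0 fun n ω => ?_
    rw [norm_sub_rev]
    exact X.abs_mass₁_sub_mass₂_le p n ω t

theorem integral_indicator_one_mul (a : ℝ → ℝ) {t : ℝ} (ht : t ∈ Ioc 0 X.T) :
    ∫ s in (0 : ℝ)..X.T, indicator (Icc 0 t) (1 : ℝ → ℝ) s * a s = ∫ s in (0 : ℝ)..t, a s := by
  rw [← intervalIntegral.integral_indicator (Ioc_subset_Icc_self ht)]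
  refine intervalIntegral.integral_congr_ae (.of_forall fun s hs => ?_)
  rw [uIoc_of_le X.T_pos.le] at hs
  by_cases h : s ≤ t <;> simp [indicator, h, hs.1.le]

theorem Psi₁_indicator (p n : ℕ) (ω : Ω) (a : ℝ → ℝ) {t : ℝ} (ht : t ∈ Ioc 0 X.T) :
    X.Psi₁ p n ω (indicator (Icc 0 t) 1) a = X.mass₁ p n ω t - ∫ s in (0 : ℝ)..t, a s := by
  have hb := inv_nonneg.2 (X.b_pos n).le
  rw [Psi₁, integral_indicator_one_mul a ht, nu₁, setIntegral_sum_dirac (fun i => ?_)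
    (fun i => Obs.time_nonneg X.T_pos _) ht.2, mass₁, Obs.diagSum, Finset.mul_sum]
  · simp only [mul_ite, mul_zero, G]
  · exact mul_nonneg hb ((Obs.isSubinvariant X.T_pos _ _).pow_nonneg p i i)

theorem Psi₂_indicator (p n : ℕ) (ω : Ω) (a : ℝ → ℝ) {t : ℝ} (ht : t ∈ Ioc 0 X.T) :
    X.Psi₂ p n ω (indicator (Icc 0 t) 1) a = X.mass₂ p n ω t - ∫ s in (0 : ℝ)..t, a s := by
  have hb := inv_nonneg.2 (X.b_pos n).le
  have hG : (X.G n ω).transpose = Obs.G X.T (X.path n 1 ω) (X.path n 0 ω) := Obs.G_transpose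
  have hG' : X.G n ω = (Obs.G X.T (X.path n 1 ω) (X.path n 0 ω)).transpose :=
    Obs.G_transpose.symm
  rw [Psi₂, integral_indicator_one_mul a ht, nu₂, setIntegral_sum_dirac (fun i => ?_)
    (fun i => Obs.time_nonneg X.T_pos _) ht.2, mass₂, Obs.diagSum, Finset.mul_sum]
  · simp only [mul_ite, mul_zero, hG']
    simp only [Matrix.transpose_transpose]
  · rw [hG, hG']
    exact mul_nonneg hb ((Obs.isSubinvariant X.T_pos _ _).pow_nonneg p i i)

theorem conv_mass₁_iff (p : ℕ) (a : ℝ → Ω → ℝ) :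
    X.Conv P (X.mass₁ p) a ↔ ∀ t ∈ Ioc 0 X.T, TendstoInMeasure P
      (fun n ω => X.Psi₁ p n ω (indicator (Icc 0 t) 1) (fun s => a s ω)) atTop (fun _ => 0) := by
  refine forall₂_congr fun t ht => ?_
  simp only [Psi₁_indicator _ _ _ _ ht, tendstoInMeasure_sub_iff]

theorem conv_mass₂_iff (p : ℕ) (a : ℝ → Ω → ℝ) :
    X.Conv P (X.mass₂ p) a ↔ ∀ t ∈ Ioc 0 X.T, TendstoInMeasure P
      (fun n ω => X.Psi₂ p n ω (indicator (Icc 0 t) 1) (fun s => a s ω)) atTop (fun _ => 0) := by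
  refine forall₂_congr fun t ht => ?_
  simp only [Psi₂_indicator _ _ _ _ ht, tendstoInMeasure_sub_iff]

theorem powerSeries_mass₁ {z : ℂ} (hz : ‖z‖ < 1) (n : ℕ) (ω : Ω) (t : ℝ) :
    powerSeries X.mass₁ z n ω t = (X.b n : ℂ)⁻¹ *
      (Obs.resolvent X.T (X.path n 0 ω) (X.path n 1 ω) z * X.E₁ n ω t).trace := by
  rw [E₁, ← (Obs.hasSum_trace_resolvent X.T_pos hz t).tsum_eq, ← tsum_mul_left]
  simp only [powerSeries, mass₁, Complex.real_smul, Complex.ofReal_mul, Complex.ofReal_inv,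
    mul_assoc]

theorem powerSeries_mass₂ {z : ℂ} (hz : ‖z‖ < 1) (n : ℕ) (ω : Ω) (t : ℝ) :
    powerSeries X.mass₂ z n ω t = (X.b n : ℂ)⁻¹ *
      (Obs.resolvent X.T (X.path n 1 ω) (X.path n 0 ω) z * X.E₂ n ω t).trace := by
  rw [E₂, ← (Obs.hasSum_trace_resolvent X.T_pos hz t).tsum_eq, ← tsum_mul_left]
  simp only [powerSeries, mass₂, Complex.real_smul, Complex.ofReal_mul, Complex.ofReal_inv,
    mul_assoc]

theorem inv_b_mul_A {z : ℂ} (hz : ‖z‖ < 1) (x y w : ℂ) (n : ℕ) (ω : Ω) (t : ℝ) :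
    (X.b n : ℂ)⁻¹ * X.A n ω (x • X.E₁ n ω t) (y • X.E₂ n ω t)
      (w • (X.E₁ n ω t * (X.G n ω).map Complex.ofReal)) (z • X.one n ω) =
      x * powerSeries X.mass₁ z n ω t + y * powerSeries X.mass₂ z n ω t -
        2 * w / z * (powerSeries X.mass₁ z n ω t - X.mass₁ 0 n ω t) := by
  have h := Obs.A_smul_one (N₁ := X.path n 0 ω) (N₂ := X.path n 1 ω) X.T_pos hz x y w t
  have h2 := Obs.sq_mul_trace_resolvent (N₁ := X.path n 0 ω) (N₂ := X.path n 1 ω) X.T_pos hz t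
  rw [powerSeries_mass₁ hz, powerSeries_mass₂ hz, mass₁, A, E₁, E₂, G, one, h,
    Complex.ofReal_mul, Complex.ofReal_inv, ← mul_sub (X.b n : ℂ)⁻¹, ← h2]
  -- At `z = 0` the mixed term vanishes, and so does `2 * w / z` by the convention on division by
  -- zero.
  rcases eq_or_ne z 0 with rfl | hz0
  · ring
  · field_simp

theorem inv_b_mul_A_E₁ {z : ℂ} (hz : ‖z‖ < 1) (n : ℕ) (ω : Ω) (t : ℝ) :
    (X.b n : ℂ)⁻¹ * X.A n ω (X.E₁ n ω t) 0 0 (z • X.one n ω) = powerSeries X.mass₁ z n ω t := by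
  simpa using inv_b_mul_A hz 1 0 0 n ω t

theorem inv_b_mul_A_E₂ {z : ℂ} (hz : ‖z‖ < 1) (n : ℕ) (ω : Ω) (t : ℝ) :
    (X.b n : ℂ)⁻¹ * X.A n ω 0 (X.E₂ n ω t) 0 (z • X.one n ω) = powerSeries X.mass₂ z n ω t := by
  simpa using inv_b_mul_A hz 0 1 0 n ω t

end SamplingScheme

/-! ### Equivalence of the conditions and the limit of `A_n` -/

namespace SamplingScheme

variable {Ω : Type*} [mΩ : MeasurableSpace Ω] {X : SamplingScheme Ω} {P : Measure Ω}

theorem condA_iff {η : ℝ} (hη : η ≤ 1) {α : ℂ → ℝ → Ω → ℂ} :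
    X.CondA P η α ↔ (∀ z, ‖z‖ < η → X.IsDensity P (α z)) ∧
      (∀ ω, ∀ t ∈ Icc 0 X.T, ContinuousOn (fun z => α z t ω) (Metric.ball 0 η)) ∧
      ∀ z, ‖z‖ < η → X.Conv P (powerSeries X.mass₁ z) (α z) := by
  have h : ∀ z : ℂ, ‖z‖ < η → (X.Conv P (powerSeries X.mass₁ z) (α z) ↔
      ∀ t ∈ Ioc 0 X.T, TendstoInMeasure P
        (fun n ω => ((X.b n)⁻¹ : ℂ) * X.A n ω (X.E₁ n ω t) 0 0 (z • X.one n ω)) atTop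
        (fun ω => ∫ s in (0 : ℝ)..t, α z s ω)) := fun z hz => by
    simp only [inv_b_mul_A_E₁ (hz.trans_le hη)]
    rfl
  exact ⟨fun H => ⟨H.density, H.cont, fun z hz => (h z hz).2 (H.conv z hz)⟩,
    fun H => ⟨H.1, H.2.1, fun z hz => (h z hz).1 (H.2.2 z hz)⟩⟩

theorem condC_iff {η : ℝ} (hη : η ≤ 1) {γ : ℂ → ℝ → Ω → ℂ} :
    X.CondC P η γ ↔ (∀ z, ‖z‖ < η → X.IsDensity P (γ z)) ∧
      (∀ ω, ∀ t ∈ Icc 0 X.T, ContinuousOn (fun z => γ z t ω) (Metric.ball 0 η)) ∧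
      ∀ z, ‖z‖ < η → X.Conv P (powerSeries X.mass₂ z) (γ z) := by
  have h : ∀ z : ℂ, ‖z‖ < η → (X.Conv P (powerSeries X.mass₂ z) (γ z) ↔
      ∀ t ∈ Ioc 0 X.T, TendstoInMeasure P
        (fun n ω => ((X.b n)⁻¹ : ℂ) * X.A n ω 0 (X.E₂ n ω t) 0 (z • X.one n ω)) atTop
        (fun ω => ∫ s in (0 : ℝ)..t, γ z s ω)) := fun z hz => by
    simp only [inv_b_mul_A_E₂ (hz.trans_le hη)]
    rfl
  exact ⟨fun H => ⟨H.density, H.cont, fun z hz => (h z hz).2 (H.conv z hz)⟩,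
    fun H => ⟨H.1, H.2.1, fun z hz => (h z hz).1 (H.2.2 z hz)⟩⟩

theorem condA'_iff {a : ℕ → ℝ → Ω → ℝ} :
    X.CondA' P a ↔ ∀ p, 1 ≤ p → X.IsDensity P (a p) ∧ X.Conv P (X.mass₁ p) (a p) :=
  ⟨fun H p hp => ⟨H.density p hp, (conv_mass₁_iff p _).2 (H.conv p hp)⟩,
    fun H => ⟨fun p hp => (H p hp).1, fun p hp => (conv_mass₁_iff p _).1 (H p hp).2⟩⟩

theorem condC'_iff {c : ℕ → ℝ → Ω → ℝ} :
    X.CondC' P c ↔ ∀ p, 1 ≤ p → X.IsDensity P (c p) ∧ X.Conv P (X.mass₂ p) (c p) :=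
  ⟨fun H p hp => ⟨H.density p hp, (conv_mass₂_iff p _).2 (H.conv p hp)⟩,
    fun H => ⟨fun p hp => (H p hp).1, fun p hp => (conv_mass₂_iff p _).1 (H p hp).2⟩⟩

/-- The process `a` with the element number zero replaced by `a₀`. -/
def setZero (a₀ : ℝ → Ω → ℝ) (a : ℕ → ℝ → Ω → ℝ) : ℕ → ℝ → Ω → ℝ
  | 0 => a₀
  | p + 1 => a (p + 1)

/-- The condition constrains only `p ≥ 1`, so the entry at `0` is free to be the process given by
(5). -/
theorem condA'_setZero {a₀ : ℝ → Ω → ℝ} {a : ℕ → ℝ → Ω → ℝ} (h : X.CondA' P a) :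
    X.CondA' P (setZero a₀ a) := by
  rw [condA'_iff] at *
  rintro (_ | p) hp
  · omega
  · exact h _ hp

theorem condC'_setZero {c₀ : ℝ → Ω → ℝ} {c : ℕ → ℝ → Ω → ℝ} (h : X.CondC' P c) :
    X.CondC' P (setZero c₀ c) := by
  rw [condC'_iff] at *
  rintro (_ | p) hp
  · omega
  · exact h _ hp

theorem condA'_iff_condC' {a : ℕ → ℝ → Ω → ℝ} : X.CondA' P a ↔ X.CondC' P a := by
  rw [condA'_iff, condC'_iff]
  refine forall_congr' fun p => ?_
  cases p with
  | zero => simp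
  | succ p => simp only [conv_mass₁_iff_conv_mass₂]

/-- Densities of the power series on a complex disc yield densities of the coefficients. -/
theorem exists_isDensity_coeff_of_powerSeries [IsFiniteMeasure P]
    {U : ℕ → ℕ → Ω → ℝ → ℝ} (hU : ∀ p, Dom 1 (U p) (U 0)) {a₀ : ℝ → Ω → ℝ}
    (ha₀ : X.IsDensity P a₀) (hc₀ : X.Conv P (U 0) a₀) {η : ℝ} (hη : η ∈ Ioo 0 1)
    {α : ℂ → ℝ → Ω → ℂ} (hα : ∀ z, ‖z‖ < η → X.IsDensity P (α z))
    (hc : ∀ z, ‖z‖ < η → X.Conv P (powerSeries U z) (α z)) (p : ℕ) :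
    ∃ d, X.IsDensity P d ∧ X.Conv P (U p) d := by
  have hr : ∀ r ∈ Ioo 0 η, ‖(r : ℂ)‖ < η := fun r hr => by
    rw [Complex.norm_real, Real.norm_of_nonneg hr.1.le]
    exact hr.2
  -- At a real argument the series is real, so its real part carries all the information.
  refine exists_isDensity_coeff hU ha₀ hc₀ hη.1 hη.2.le
    (α := fun r t ω => Complex.reCLM (α r t ω)) (fun r h => (hα r (hr r h)).map _)
    (fun r h => ?_) p
  convert (hc r (hr r h)).map Complex.reCLM (hα r (hr r h)) using 4 with n ω t
  exact (tsum_ofReal_pow _ r).symm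

theorem A3With.exists_condA' [IsFiniteMeasure P] {a₀ c₀ : ℝ → Ω → ℝ} (h : X.A3With P a₀ c₀) :
    ∃ a, X.CondA' P a := by
  obtain ⟨hB, ⟨η, hη, α, hα⟩ | ⟨η, hη, γ, hγ⟩⟩ := h
  · rw [condA_iff hη.2.le] at hα
    choose a ha using exists_isDensity_coeff_of_powerSeries X.dom_mass₁ hB.density₁
      ((conv_mass₁_iff 0 _).2 hB.conv₁) hη hα.1 hα.2.2
    exact ⟨a, condA'_iff.2 fun p _ => ha p⟩
  · rw [condC_iff hη.2.le] at hγ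
    choose c hc using exists_isDensity_coeff_of_powerSeries X.dom_mass₂ hB.density₂
      ((conv_mass₂_iff 0 _).2 hB.conv₂) hη hγ.1 hγ.2.2
    exact ⟨c, condA'_iff_condC'.2 (condC'_iff.2 fun p _ => hc p)⟩

theorem Base.forall_mass₁ {a₀ c₀ : ℝ → Ω → ℝ} (hB : X.Base P a₀ c₀) {a : ℕ → ℝ → Ω → ℝ}
    (h0 : a 0 = a₀) (ha : X.CondA' P a) :
    (∀ p, X.IsDensity P (a p)) ∧ ∀ p, X.Conv P (X.mass₁ p) (a p) := by
  refine forall_and.1 fun p => ?_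
  rcases Nat.eq_zero_or_pos p with rfl | hp
  · rw [h0]
    exact ⟨hB.density₁, (conv_mass₁_iff 0 _).2 hB.conv₁⟩
  · exact condA'_iff.1 ha p hp

theorem Base.forall_mass₂ {a₀ c₀ : ℝ → Ω → ℝ} (hB : X.Base P a₀ c₀) {c : ℕ → ℝ → Ω → ℝ}
    (h0 : c 0 = c₀) (hc : X.CondC' P c) :
    (∀ p, X.IsDensity P (c p)) ∧ ∀ p, X.Conv P (X.mass₂ p) (c p) := by
  refine forall_and.1 fun p => ?_
  rcases Nat.eq_zero_or_pos p with rfl | hp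
  · rw [h0]
    exact ⟨hB.density₂, (conv_mass₂_iff 0 _).2 hB.conv₂⟩
  · exact condC'_iff.1 hc p hp

theorem Base.exists_condA [IsFiniteMeasure P] {a₀ c₀ : ℝ → Ω → ℝ} (hB : X.Base P a₀ c₀)
    {a : ℕ → ℝ → Ω → ℝ} (ha : X.CondA' P a) : ∃ α, X.CondA P 1 α := by
  obtain ⟨h1, h2⟩ := hB.forall_mass₁ (a := setZero a₀ a) rfl (condA'_setZero ha)
  obtain ⟨α, hα, hα', hα'', -⟩ := exists_isDensity_powerSeries X.dom_mass₁ h1 h2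
  exact ⟨α, (condA_iff le_rfl).2 ⟨hα, hα', hα''⟩⟩

theorem Base.exists_condC [IsFiniteMeasure P] {a₀ c₀ : ℝ → Ω → ℝ} (hB : X.Base P a₀ c₀)
    {c : ℕ → ℝ → Ω → ℝ} (hc : X.CondC' P c) : ∃ γ, X.CondC P 1 γ := by
  obtain ⟨h1, h2⟩ := hB.forall_mass₂ (c := setZero c₀ c) rfl (condC'_setZero hc)
  obtain ⟨γ, hγ, hγ', hγ'', -⟩ := exists_isDensity_powerSeries X.dom_mass₂ h1 h2
  exact ⟨γ, (condC_iff le_rfl).2 ⟨hγ, hγ', hγ''⟩⟩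

theorem CondA.mono {η η' : ℝ} {α : ℂ → ℝ → Ω → ℂ} (h : X.CondA P η α) (hη : η' ≤ η) :
    X.CondA P η' α :=
  ⟨fun z hz => h.density z (hz.trans_le hη),
    fun ω t ht => (h.cont ω t ht).mono (Metric.ball_subset_ball hη),
    fun z hz => h.conv z (hz.trans_le hη)⟩

theorem a3_iff_a3' [IsFiniteMeasure P] : X.A3 P ↔ X.A3' P := by
  constructor
  · rintro ⟨a₀, c₀, h⟩
    exact ⟨a₀, c₀, h.1, Or.inl h.exists_condA'⟩
  · rintro ⟨a₀, c₀, hB, h⟩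
    obtain ⟨a, ha⟩ : ∃ a, X.CondA' P a := h.elim id fun ⟨c, hc⟩ => ⟨c, condA'_iff_condC'.2 hc⟩
    obtain ⟨α, hα⟩ := hB.exists_condA ha
    -- The process lives on the whole unit disc; any radius in `(0, 1)` would do.
    exact ⟨a₀, c₀, hB, Or.inl ⟨1 / 2, by norm_num, α, hα.mono (by norm_num)⟩⟩

theorem ae_abs_coeff_le {U : ℕ → ℕ → Ω → ℝ → ℝ} (hU : ∀ p, Dom 1 (U p) (U 0))
    {a : ℕ → ℝ → Ω → ℝ} (ha : ∀ p, X.IsDensity P (a p)) (hc : ∀ p, X.Conv P (U p) (a p)) :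
    ∀ᵐ ω ∂P, ∀ t ∈ Ioc 0 X.T, ∀ p, |a p t ω| ≤ a 0 t ω := by
  filter_upwards [ae_all_iff.2 (ae_abs_le hU ha hc)] with ω hω t ht p
  simpa using hω p t ht

theorem summable_mul_even_pow {v : ℕ → ℝ} {g : ℝ} (hv : ∀ p, |v p| ≤ g) {ρ : ℝ}
    (hρ : ρ ∈ Ioo (-1 : ℝ) 1) : Summable fun p => v p * ρ ^ (2 * p) :=
  summable_smul_of_bounded hv (c := fun p => ρ ^ (2 * p))
    (summable_norm_even_pow (abs_lt.2 hρ))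

theorem exists_isDensity_limitDensity [IsFiniteMeasure P] {a c : ℕ → ℝ → Ω → ℝ}
    (ha : ∀ p, X.IsDensity P (a p)) (hca : ∀ p, X.Conv P (X.mass₁ p) (a p))
    (hc : ∀ p, X.IsDensity P (c p)) (hcc : ∀ p, X.Conv P (X.mass₂ p) (c p)) (x y : ℝ) {ρ : ℝ}
    (hρ : ρ ∈ Ioo (-1 : ℝ) 1) (ρs : ℝ) :
    ∃ D : ℝ → Ω → ℂ, X.IsDensity P D ∧
      X.Conv P (fun n ω t => ((X.b n)⁻¹ : ℂ) *
        X.A n ω ((x ^ 2 : ℂ) • X.E₁ n ω t) ((y ^ 2 : ℂ) • X.E₂ n ω t)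
          ((x * y * ρs : ℂ) • (X.E₁ n ω t * (X.G n ω).map Complex.ofReal))
          ((ρ : ℂ) • X.one n ω)) D ∧
      ∀ᵐ ω ∂P, ∀ t ∈ Ioc 0 X.T, D t ω = (limitDensity a c x y ρ ρs t ω : ℂ) := by
  have hρ' : ‖(ρ : ℂ)‖ < 1 := by rw [Complex.norm_real]; exact abs_lt.2 hρ
  obtain ⟨α, hα, -, hα', hαs⟩ := exists_isDensity_powerSeries X.dom_mass₁ ha hca
  obtain ⟨γ, hγ, -, hγ', hγs⟩ := exists_isDensity_powerSeries X.dom_mass₂ hc hcc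
  let e : ℂ → ℂ →L[ℝ] ℂ := fun w => ContinuousLinearMap.mul ℝ ℂ w
  -- This is `0` when `ρ = 0`, in agreement with the indicator in `limitDensity`.
  let w : ℂ := 2 * (x * y * ρs) / ρ
  have d1 := (hα ρ hρ').map (e (x ^ 2))
  have d2 := (hγ ρ hρ').map (e (y ^ 2))
  have d3 := (ha 0).map Complex.ofRealCLM
  have d4 := ((hα ρ hρ').sub d3).map (e w)
  have k1 := (hα' ρ hρ').map (e (x ^ 2)) (hα ρ hρ')
  have k2 := (hγ' ρ hρ').map (e (y ^ 2)) (hγ ρ hρ')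
  have k3 := (hca 0).map Complex.ofRealCLM (ha 0)
  have k4 := ((hα' ρ hρ').sub k3 (hα ρ hρ') d3).map (e w) ((hα ρ hρ').sub d3)
  refine ⟨_, (d1.add d2).sub d4, ?_, ?_⟩
  · have := (k1.add k2 d1 d2).sub k4 (d1.add d2) d4
    simp only [inv_b_mul_A hρ']
    exact this
  · filter_upwards [hαs, hγs] with ω h1 h2 t ht
    have hs : ∀ v : ℕ → ℝ, ∑' p, v p • (ρ : ℂ) ^ (2 * p) = ((∑' p, v p * ρ ^ (2 * p) : ℝ) : ℂ) :=
      fun v => by rw [Complex.ofReal_tsum]; simp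
    simp only [e, ContinuousLinearMap.mul_apply', Complex.ofRealCLM_apply, (h1 t ht).2,
      (h2 t ht).2, hs, limitDensity, evenSeries, w]
    rcases eq_or_ne ρ 0 with rfl | h0
    · simp
    · rw [if_pos h0]
      push_cast
      ring

theorem intervalIntegrable_and_tendsto_limitDensity [IsFiniteMeasure P] {a c : ℕ → ℝ → Ω → ℝ}
    (ha : ∀ p, X.IsDensity P (a p)) (hca : ∀ p, X.Conv P (X.mass₁ p) (a p))
    (hc : ∀ p, X.IsDensity P (c p)) (hcc : ∀ p, X.Conv P (X.mass₂ p) (c p)) (x y : ℝ) {ρ : ℝ}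
    (hρ : ρ ∈ Ioo (-1 : ℝ) 1) (ρs : ℝ) {t : ℝ} (ht : t ∈ Ioc 0 X.T) :
    (∀ᵐ ω ∂P, IntervalIntegrable (fun s => limitDensity a c x y ρ ρs s ω) volume 0 t) ∧
      TendstoInMeasure P (fun n ω => ((X.b n)⁻¹ : ℂ) *
        X.A n ω ((x ^ 2 : ℂ) • X.E₁ n ω t) ((y ^ 2 : ℂ) • X.E₂ n ω t)
          ((x * y * ρs : ℂ) • (X.E₁ n ω t * (X.G n ω).map Complex.ofReal))
          ((ρ : ℂ) • X.one n ω)) atTop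
        (fun ω => ((∫ s in (0 : ℝ)..t, limitDensity a c x y ρ ρs s ω : ℝ) : ℂ)) := by
  obtain ⟨D, hD, hDc, hDe⟩ := exists_isDensity_limitDensity ha hca hc hcc x y hρ ρs
  constructor
  · filter_upwards [hDe, (hD.map Complex.reCLM).integrable] with ω h1 h2
    refine (intervalIntegrable_of_mem_Icc h2 (Ioc_subset_Icc_self ht)).congr fun s hs => ?_
    rw [uIoc_of_le ht.1.le] at hs
    simp [h1 s ⟨hs.1, hs.2.trans ht.2⟩]
  · refine ((hDc.congr hDe) t ht).congr_right (.of_forall fun ω => ?_)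
    exact intervalIntegral.integral_ofReal

end SamplingScheme

end

/-- Equivalence of [A3] and [A3'], power series of the densities, and limit of the functional `A_n`.
The proof does not use that the mesh tends to zero: replacing `1_{I ∩ [0, t] ≠ ∅}` by
`1_{J ∩ [0, t] ≠ ∅}` in a trace changes it by at most `2`, which is negligible since `b_n → ∞`. -/
theorem proposition2 {Ω : Type*} [MeasurableSpace Ω] (P : Measure Ω) [IsProbabilityMeasure P]
    (X : SamplingScheme Ω) (hA2 : X.A2 P) :
    (X.A3 P ↔ X.A3' P) ∧
    ∀ a₀ c₀ : ℝ → Ω → ℝ, X.A3With P a₀ c₀ →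
      -- both alternatives of the two conditions hold, with the given `a₀`, `c₀`
      (∃ a c : ℕ → ℝ → Ω → ℝ, a 0 = a₀ ∧ c 0 = c₀ ∧ X.CondA' P a ∧ X.CondC' P c) ∧
      (∃ a, X.CondA P 1 a) ∧ (∃ c, X.CondC P 1 c) ∧
      ∀ a c : ℕ → ℝ → Ω → ℝ, a 0 = a₀ → c 0 = c₀ → X.CondA' P a → X.CondC' P c →
        -- `a(z, t) = ∑ a_p(t) z^{2p}` and `c(z, t) = ∑ c_p(t) z^{2p}`
        (∀ η ∈ Ioc (0 : ℝ) 1, ∀ α, X.CondA P η α → ∀ᵐ ω ∂P, ∀ t ∈ Ioc 0 X.T, ∀ z : ℂ, ‖z‖ < η →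
          HasSum (fun p => (a p t ω : ℂ) * z ^ (2 * p)) (α z t ω)) ∧
        (∀ η ∈ Ioc (0 : ℝ) 1, ∀ γ, X.CondC P η γ → ∀ᵐ ω ∂P, ∀ t ∈ Ioc 0 X.T, ∀ z : ℂ, ‖z‖ < η →
          HasSum (fun p => (c p t ω : ℂ) * z ^ (2 * p)) (γ z t ω)) ∧
        (∀ᵐ ω ∂P, ∀ t ∈ Ioc 0 X.T, ∀ ρ ∈ Ioo (-1 : ℝ) 1,
          Summable (fun p => a p t ω * ρ ^ (2 * p)) ∧
          Summable (fun p => c p t ω * ρ ^ (2 * p))) ∧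
        -- the convergence in probability
        ∀ x y : ℝ, ∀ ρ ∈ Ioo (-1 : ℝ) 1, ∀ ρs ∈ Ioo (-1 : ℝ) 1, ∀ t ∈ Ioc 0 X.T,
          (∀ᵐ ω ∂P, IntervalIntegrable (fun s => limitDensity a c x y ρ ρs s ω) volume 0 t) ∧
          TendstoInMeasure P
            (fun n ω => ((X.b n)⁻¹ : ℂ) *
              X.A n ω ((x ^ 2 : ℂ) • X.E₁ n ω t) ((y ^ 2 : ℂ) • X.E₂ n ω t)
                ((x * y * ρs : ℂ) • (X.E₁ n ω t * (X.G n ω).map Complex.ofReal))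
                ((ρ : ℂ) • X.one n ω))
            atTop
            (fun ω => ((∫ s in (0 : ℝ)..t, limitDensity a c x y ρ ρs s ω : ℝ) : ℂ)) := by
  refine ⟨SamplingScheme.a3_iff_a3', fun a₀ c₀ h => ?_⟩
  obtain ⟨a', ha'⟩ := h.exists_condA'
  have hc' := SamplingScheme.condA'_iff_condC'.1 ha'
  refine ⟨⟨SamplingScheme.setZero a₀ a', SamplingScheme.setZero c₀ a', rfl, rfl,
    SamplingScheme.condA'_setZero ha', SamplingScheme.condC'_setZero hc'⟩,
    h.1.exists_condA ha', h.1.exists_condC hc', fun a c ha0 hc0 ha hc => ?_⟩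
  obtain ⟨a1, a2⟩ := h.1.forall_mass₁ ha0 ha
  obtain ⟨c1, c2⟩ := h.1.forall_mass₂ hc0 hc
  refine ⟨fun η hη α hα => ?_, fun η hη γ hγ => ?_, ?_, fun x y ρ hρ ρs _ t ht =>
    SamplingScheme.intervalIntegrable_and_tendsto_limitDensity a1 a2 c1 c2 x y hρ ρs ht⟩
  · obtain ⟨h1, h2, h3⟩ := (SamplingScheme.condA_iff hη.2).1 hα
    exact SamplingScheme.ae_hasSum_of_conv X.dom_mass₁ a1 a2 hη.2 h1 h2 h3
  · obtain ⟨h1, h2, h3⟩ := (SamplingScheme.condC_iff hη.2).1 hγ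
    exact SamplingScheme.ae_hasSum_of_conv X.dom_mass₂ c1 c2 hη.2 h1 h2 h3
  · filter_upwards [SamplingScheme.ae_abs_coeff_le X.dom_mass₁ a1 a2,
      SamplingScheme.ae_abs_coeff_le X.dom_mass₂ c1 c2] with ω h1 h2 t ht ρ hρ
    exact ⟨SamplingScheme.summable_mul_even_pow (h1 t ht) hρ,
      SamplingScheme.summable_mul_even_pow (h2 t ht) hρ⟩
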